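/- Let $M$ be a finite-dimensional paracompact smooth manifold, $\pi:TM\to M$ its tangent bundle and $\mathcal TM=TM\setminus\{0\}$ the slit tangent bundle. A $\pi$-vector field is a section $\overline X$ of the pullback of $TM$ along $\pi$, i.e. $\overline X(u)\in T_{\pi(u)}M$. Let $\gamma:T_{\pi(u)}M\to T_u(TM)$ be the vertical lift, $\rho=d\pi:T_u(TM)\to T_{\pi(u)}M$, $J=\gamma\circ\rho$, $\overline\eta(u)=u$, and $\mathcal C=\gamma\overline\eta$; for a function $f$ put $d_Jf=df\circ J$. A Finsler metric on $M$ is a continuous function $F:TM\to[0,\infty)$ that is smooth on $\mathcal TM$, positively homogeneous of degree $1$ in the fibre variable, and such that $dd_J(\tfrac12F^2)$ has maximal rank on $\mathcal TM$. A conic pseudo-Finsler structure is a smooth function $F:\mathcal D\to[0,\infty)$, positively homogeneous of degree $1$, with $dd_J(\tfrac12F^2)$ of maximal rank on $\mathcal D$, where $\mathcal D\subset\mathcal TM$ is non-empty, open, invariant under multiplication by positive scalars, has connected fibres, and satisfies $\pi(\mathcal D)=M$. In both cases write $E=\tfrac12F^2$; the metric tensor $g$ is given by $g(\rho W,\rho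 Z)=dd_JE(JW,Z)$, the geodesic spray $G$ by $i_G\,dd_JE=-dE$, the Barthel connection by $\Gamma=[J,G]$, i.e. $\Gamma W=[JW,G]-J[W,G]$; $v=\tfrac12(I-\Gamma)$ is the vertical projector, and the horizontal map $\beta$ is the inverse of the restriction of $\rho$ to the horizontal space $\ker v$. The Berwald connection $D^\circ$ of a Finsler metric $F$ is given by $$\gamma D^\circ_{\beta\overline X}\overline Y=v[\beta\overline X,\gamma\overline Y],\qquad D^\circ_{\gamma\overline X}\overline Y=\rho[\gamma\overline X,\beta\overline Y],$$ and its Cartan connection $\nabla$ by $$2g(\nabla_{\gamma\overline X}\overline Y,\overline Z)=\gamma\overline X\cdot g(\overline Y,\overline Z)+g(\overline Y,\rho[\beta\overline Z,\gamma\overline X])+g(\overline Z,\rho[\gamma\overline X,\beta\overline Y]),$$ $$2g(\nabla_{\beta\overline X}\overline Y,\overline Z)=\beta\overline X\cdot g(\overline Y,\overline Z)+\beta\overline Y\cdot g(\overline Z,\overline X)-\beta\overline Z\cdot g(\overline X,\overline Y)-g(\overline X,\rho[\beta\overline Y,\beta\overline Z])+g(\overline Y,\rho[\beta\overline Z,\beta\overline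 X])+g(\overline Z,\rho[\beta\overline X,\beta\overline Y]).$$ Let $F$ be a Finsler metric on $M$ and let $\overline\varphi$ be a concurrent $\pi$-vector field of $F$: a smooth, nowhere vanishing $\pi$-vector field over $\mathcal TM$ such that for all $\overline W$ $$\nabla_{\beta\overline W}\overline\varphi=-\overline W=D^\circ_{\beta\overline W}\overline\varphi,\qquad \nabla_{\gamma\overline W}\overline\varphi=0=D^\circ_{\gamma\overline W}\overline\varphi .$$ Put $\Phi=g(\overline\varphi,\overline\eta)$, $p^2=g(\overline\varphi,\overline\varphi)$, $\mathcal D=\{u\in\mathcal TM: F(u)>\Phi(u)\}$ and $\widehat F=\dfrac{F^2}{F-\Phi}$ on $\mathcal D$. Assume that $\widehat F$ is a conic pseudo-Finsler structure on $\mathcal D$ and that $F(1+2p^2)-3\Phi\neq0$ on $\mathcal D$, and put $$f_1=\frac{F(4\Phi-F)}{F(1+2p^2)-3\Phi},\qquad f_2=\frac{2F^3}{F(1+2p^2)-3\Phi}.$$ **Proposition.** On $\mathcal D$ the Barthel connection $\widehat\Gamma$ of $\widehat F$ and the Barthel connection $\Gamma$ of $F$ are related by $$\widehat\Gamma=\Gamma-f_1J-d_Jf_1\otimes\gamma\overline\eta+d_Jf_2\otimes\gamma\overline\varphi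 .$$ Consequently, for every $u\in\mathcal D$ and every $\overline W\in T_{\pi(u)}M$, the horizontal map $\widehat\beta$ of $\widehat F$ is $$\widehat\beta\,\overline W=\beta\overline W-\tfrac12\left\{f_1\,\gamma\overline W+d_Jf_1(\beta\overline W)\,\gamma\overline\eta-d_Jf_2(\beta\overline W)\,\gamma\overline\varphi\right\}.$$ -/

import Mathlib

open scoped Manifold ContDiff
open Bundle

noncomputable section

namespace FinslerGeom

/-! Throughout, `M` is a smooth manifold modelled on the finite-dimensional real vector space `E`,
and `TangentBundle 𝓘(ℝ, E) M` is its tangent bundle `TM`; a point `u` of `TM` has base point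
`u.proj` and vector part `u.snd`. -/

variable {E : Type*} [NormedAddCommGroup E] [NormedSpace ℝ E]
  {M : Type*} [TopologicalSpace M] [ChartedSpace E M] [IsManifold 𝓘(ℝ, E) ∞ M]

variable (E M) in
/-- A vector field on `TM` (not necessarily smooth). -/
abbrev TMField : Type _ :=
  (u : TangentBundle 𝓘(ℝ, E) M) → TangentSpace 𝓘(ℝ, E).tangent u

variable (E M) in
/-- A `π`-vector field: a section of the pullback of `TM → M` along `TM → M`
(not necessarily smooth). -/
abbrev PiField : Type _ :=
  (u : TangentBundle 𝓘(ℝ, E) M) → TangentSpace 𝓘(ℝ, E) u.proj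

variable (E M) in
/-- The slit tangent bundle: `TM` without the zero section. -/
def slit : Set (TangentBundle 𝓘(ℝ, E) M) := {u | u.snd ≠ 0}

/-- The `π`-vector field `X` is smooth at `u`. -/
def PiSmoothAt (X : PiField E M) (u : TangentBundle 𝓘(ℝ, E) M) : Prop :=
  ContMDiffAt 𝓘(ℝ, E).tangent 𝓘(ℝ, E).tangent ∞
    (fun p => (⟨p.proj, X p⟩ : TangentBundle 𝓘(ℝ, E) M)) u

/-- The injection `γ`: the vertical lift, i.e. the derivative at `u` of the inclusion of the
fibre of `TM` through `u`. -/
def gam (u : TangentBundle 𝓘(ℝ, E) M) :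
    TangentSpace 𝓘(ℝ, E) u.proj →L[ℝ] TangentSpace 𝓘(ℝ, E).tangent u :=
  mfderiv 𝓘(ℝ, E) 𝓘(ℝ, E).tangent
    (fun y : E => (⟨u.proj, y⟩ : TangentBundle 𝓘(ℝ, E) M)) u.snd

/-- The projection `ρ`: the derivative of `π : TM → M` at `u`. -/
def rho (u : TangentBundle 𝓘(ℝ, E) M) :
    TangentSpace 𝓘(ℝ, E).tangent u →L[ℝ] TangentSpace 𝓘(ℝ, E) u.proj :=
  mfderiv 𝓘(ℝ, E).tangent 𝓘(ℝ, E)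
    (fun p : TangentBundle 𝓘(ℝ, E) M => p.proj) u

/-- The vertical endomorphism `J = γ ∘ ρ`. -/
def vertJ (u : TangentBundle 𝓘(ℝ, E) M) :
    TangentSpace 𝓘(ℝ, E).tangent u →L[ℝ] TangentSpace 𝓘(ℝ, E).tangent u :=
  (gam u).comp (rho u)

/-- The Liouville vector field `C = γ η`, where `η(u) = u`. -/
def liouville : TMField E M := fun u => gam u u.snd

/-- The differential `df` of a function on `TM`. -/
def dFun (f : TangentBundle 𝓘(ℝ, E) M → ℝ) (u : TangentBundle 𝓘(ℝ, E) M)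
    (v : TangentSpace 𝓘(ℝ, E).tangent u) : ℝ :=
  mfderiv 𝓘(ℝ, E).tangent 𝓘(ℝ, ℝ) f u v

/-- The `1`-form `d_J f = df ∘ J`. -/
def dJ (f : TangentBundle 𝓘(ℝ, E) M → ℝ) (u : TangentBundle 𝓘(ℝ, E) M)
    (v : TangentSpace 𝓘(ℝ, E).tangent u) : ℝ :=
  dFun f u (vertJ u v)

/-- An extension of a tangent vector of `TM` at `u` to a vector field that is smooth near `u`.
It is used only to evaluate, on single vectors, operations on vector fields that are tensorial
(so that the choice of the extension is immaterial). -/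
def ext {u : TangentBundle 𝓘(ℝ, E) M} (v : TangentSpace 𝓘(ℝ, E).tangent u) : TMField E M :=
  FiberBundle.extend (E × E) v

/-- The Lie bracket of vector fields on `TM`. -/
abbrev bracket (V W : TMField E M) : TMField E M :=
  VectorField.mlieBracket 𝓘(ℝ, E).tangent V W

/-- The `2`-form `d d_J f`, by
`dω(V, W) = V·ω(W) - W·ω(V) - ω([V, W])` with `ω = d_J f`. -/
def ddJ (f : TangentBundle 𝓘(ℝ, E) M → ℝ) (u : TangentBundle 𝓘(ℝ, E) M)
    (v w : TangentSpace 𝓘(ℝ, E).tangent u) : ℝ :=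
  dFun (fun p => dJ f p (ext w p)) u v - dFun (fun p => dJ f p (ext v p)) u w
    - dJ f u (bracket (ext v) (ext w) u)

/-- The energy `½ F²`. -/
def energy (F : TangentBundle 𝓘(ℝ, E) M → ℝ) : TangentBundle 𝓘(ℝ, E) M → ℝ :=
  fun u => (1 / 2) * F u ^ 2

/-- The form `d d_J (½ F²)` is non-degenerate (of maximal rank) at `u`. -/
def MaxRankAt (F : TangentBundle 𝓘(ℝ, E) M → ℝ) (u : TangentBundle 𝓘(ℝ, E) M) : Prop :=
  ∀ v : TangentSpace 𝓘(ℝ, E).tangent u, (∀ w, ddJ (energy F) u v w = 0) → v = 0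

/-- A Finsler structure (Finsler metric) on `M`. -/
structure IsFinsler (F : TangentBundle 𝓘(ℝ, E) M → ℝ) : Prop where
  nonneg : ∀ u, 0 ≤ F u
  smooth : ContMDiffOn 𝓘(ℝ, E).tangent 𝓘(ℝ, ℝ) ∞ F (slit E M)
  continuous : Continuous F
  homogeneous : ∀ u : TangentBundle 𝓘(ℝ, E) M, ∀ c : ℝ, 0 < c →
    F ⟨u.proj, c • u.snd⟩ = c * F u
  maxRank : ∀ u ∈ slit E M, MaxRankAt F u

/-- A conic sub-bundle of `TM`: a non-empty open subset of the slit tangent bundle, invariant under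
multiplication by positive scalars, with connected fibres and projecting onto `M`. -/
structure IsConicSubbundle (D : Set (TangentBundle 𝓘(ℝ, E) M)) : Prop where
  nonempty : D.Nonempty
  isOpen : IsOpen D
  subset_slit : D ⊆ slit E M
  smul_mem : ∀ u ∈ D, ∀ c : ℝ, 0 < c → (⟨u.proj, c • u.snd⟩ : TangentBundle 𝓘(ℝ, E) M) ∈ D
  surjective : ∀ x : M, ∃ u ∈ D, u.proj = x
  connected : ∀ x : M, IsConnected {y : TangentSpace 𝓘(ℝ, E) x |
    (⟨x, y⟩ : TangentBundle 𝓘(ℝ, E) M) ∈ D}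

/-- A conic pseudo-Finsler structure on the conic sub-bundle `D`
(the values of `F` outside `D` are irrelevant). -/
structure IsConicPseudoFinsler (D : Set (TangentBundle 𝓘(ℝ, E) M))
    (F : TangentBundle 𝓘(ℝ, E) M → ℝ) : Prop where
  conic : IsConicSubbundle D
  nonneg : ∀ u ∈ D, 0 ≤ F u
  smooth : ContMDiffOn 𝓘(ℝ, E).tangent 𝓘(ℝ, ℝ) ∞ F D
  homogeneous : ∀ u ∈ D, ∀ c : ℝ, 0 < c → F ⟨u.proj, c • u.snd⟩ = c * F u
  maxRank : ∀ u ∈ D, MaxRankAt F u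

/-- The Finsler metric tensor, `g(ρ W, ρ Z) = d d_J (½ F²) (J W, Z)`;
here `W`, `Z` lift `w`, `z`, so that `J W = γ w` and `ρ Z = z`. -/
def metric (F : TangentBundle 𝓘(ℝ, E) M → ℝ) (u : TangentBundle 𝓘(ℝ, E) M)
    (w z : TangentSpace 𝓘(ℝ, E) u.proj) : ℝ :=
  ddJ (energy F) u (gam u w) (Function.invFun (rho u) z)

/-- The geodesic spray `G` of `F`, the solution of `i_G d d_J (½ F²) = - d (½ F²)`
(it is unique where `d d_J (½ F²)` has maximal rank). -/
def spray (F : TangentBundle 𝓘(ℝ, E) M → ℝ) : TMField E M := fun u =>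
  Classical.epsilon fun ξ : TangentSpace 𝓘(ℝ, E).tangent u =>
    ∀ w, ddJ (energy F) u ξ w = - dFun (energy F) u w

/-- The Barthel connection `Γ = [J, G]`, the vector `1`-form
`W ↦ [J W, G] - J [W, G]`. -/
def barthel (F : TangentBundle 𝓘(ℝ, E) M → ℝ) (u : TangentBundle 𝓘(ℝ, E) M)
    (v : TangentSpace 𝓘(ℝ, E).tangent u) : TangentSpace 𝓘(ℝ, E).tangent u :=
  bracket (fun p => vertJ p (ext v p)) (spray F) u - vertJ u (bracket (ext v) (spray F) u)

/-- The vertical projector `½ (I - Γ)`. -/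
def vProj (F : TangentBundle 𝓘(ℝ, E) M → ℝ) (u : TangentBundle 𝓘(ℝ, E) M)
    (v : TangentSpace 𝓘(ℝ, E).tangent u) : TangentSpace 𝓘(ℝ, E).tangent u :=
  (1 / 2 : ℝ) • (v - barthel F u v)

/-- The horizontal space at `u`: the kernel of the vertical projector. -/
def horSpace (F : TangentBundle 𝓘(ℝ, E) M → ℝ) (u : TangentBundle 𝓘(ℝ, E) M) :
    Set (TangentSpace 𝓘(ℝ, E).tangent u) :=
  {v | vProj F u v = 0}

/-- The horizontal map `β`, the inverse of the restriction of `ρ` to the horizontal space. -/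
def bet (F : TangentBundle 𝓘(ℝ, E) M → ℝ) (u : TangentBundle 𝓘(ℝ, E) M)
    (w : TangentSpace 𝓘(ℝ, E) u.proj) : TangentSpace 𝓘(ℝ, E).tangent u :=
  Function.invFunOn (rho u) (horSpace F u) w

/-- The vector field `γ X` of a `π`-vector field `X`. -/
def vert (X : PiField E M) : TMField E M := fun u => gam u (X u)

/-- The vector field `β X` of a `π`-vector field `X`. -/
def hor (F : TangentBundle 𝓘(ℝ, E) M → ℝ) (X : PiField E M) : TMField E M :=
  fun u => bet F u (X u)

/-- The function `g(X, Y)` of two `π`-vector fields. -/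
def metricFun (F : TangentBundle 𝓘(ℝ, E) M → ℝ) (X Y : PiField E M) :
    TangentBundle 𝓘(ℝ, E) M → ℝ :=
  fun u => metric F u (X u) (Y u)

/-- The Berwald connection in vertical directions: `D_{γ X} Y = ρ [γ X, β Y]`. -/
def berwaldVert (F : TangentBundle 𝓘(ℝ, E) M → ℝ) (X Y : PiField E M) : PiField E M :=
  fun u => rho u (bracket (vert X) (hor F Y) u)

/-- The Berwald connection in horizontal directions: `γ (D_{β X} Y) = v [β X, γ Y]`. -/
def berwaldHor (F : TangentBundle 𝓘(ℝ, E) M → ℝ) (X Y : PiField E M) : PiField E M :=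
  fun u => Function.invFun (gam u) (vProj F u (bracket (hor F X) (vert Y) u))

/-- `c` is the value at `u` of `∇_{γ X} Y` for the Cartan connection `∇`, which is defined by
`2 g(∇_{γX} Y, Z) = γX·g(Y, Z) + g(Y, ρ[βZ, γX]) + g(Z, ρ[γX, βY])` for all `Z`. -/
def IsCartanVert (F : TangentBundle 𝓘(ℝ, E) M → ℝ) (X Y : PiField E M)
    (u : TangentBundle 𝓘(ℝ, E) M) (c : TangentSpace 𝓘(ℝ, E) u.proj) : Prop :=
  ∀ Z : PiField E M, PiSmoothAt Z u →
    2 * metric F u c (Z u) =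
      dFun (metricFun F Y Z) u (vert X u)
      + metric F u (Y u) (rho u (bracket (hor F Z) (vert X) u))
      + metric F u (Z u) (rho u (bracket (vert X) (hor F Y) u))

/-- `c` is the value at `u` of `∇_{β X} Y` for the Cartan connection `∇`, which is defined by
`2 g(∇_{βX} Y, Z) = βX·g(Y, Z) + βY·g(Z, X) - βZ·g(X, Y)
  - g(X, ρ[βY, βZ]) + g(Y, ρ[βZ, βX]) + g(Z, ρ[βX, βY])` for all `Z`. -/
def IsCartanHor (F : TangentBundle 𝓘(ℝ, E) M → ℝ) (X Y : PiField E M)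
    (u : TangentBundle 𝓘(ℝ, E) M) (c : TangentSpace 𝓘(ℝ, E) u.proj) : Prop :=
  ∀ Z : PiField E M, PiSmoothAt Z u →
    2 * metric F u c (Z u) =
      dFun (metricFun F Y Z) u (hor F X u)
      + dFun (metricFun F Z X) u (hor F Y u)
      - dFun (metricFun F X Y) u (hor F Z u)
      - metric F u (X u) (rho u (bracket (hor F Y) (hor F Z) u))
      + metric F u (Y u) (rho u (bracket (hor F Z) (hor F X) u))
      + metric F u (Z u) (rho u (bracket (hor F X) (hor F Y) u))

/-- A concurrent `π`-vector field of `F`: a smooth, nowhere vanishing section over the slit tangent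
bundle with `∇_{βW} φ = -W = D_{βW} φ` and `∇_{γW} φ = 0 = D_{γW} φ` for all `W`, where `∇` and
`D` are the Cartan and the Berwald connection of `F`. -/
structure IsConcurrent (F : TangentBundle 𝓘(ℝ, E) M → ℝ) (φ : PiField E M) : Prop where
  smooth : ∀ u ∈ slit E M, PiSmoothAt φ u
  ne_zero : ∀ u ∈ slit E M, φ u ≠ 0
  cartan_hor : ∀ u ∈ slit E M, ∀ W : PiField E M, PiSmoothAt W u →
    IsCartanHor F W φ u (-(W u))
  berwald_hor : ∀ u ∈ slit E M, ∀ W : PiField E M, PiSmoothAt W u →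
    berwaldHor F W φ u = -(W u)
  cartan_vert : ∀ u ∈ slit E M, ∀ W : PiField E M, PiSmoothAt W u →
    IsCartanVert F W φ u 0
  berwald_vert : ∀ u ∈ slit E M, ∀ W : PiField E M, PiSmoothAt W u →
    berwaldVert F W φ u = 0

/-- The function `Φ = g(φ, η)`, with `η(u) = u`. -/
def bigPhi (F : TangentBundle 𝓘(ℝ, E) M → ℝ) (φ : PiField E M) :
    TangentBundle 𝓘(ℝ, E) M → ℝ :=
  fun u => metric F u (φ u) u.snd

/-- The function `p² = g(φ, φ)`. -/
def pSq (F : TangentBundle 𝓘(ℝ, E) M → ℝ) (φ : PiField E M) :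
    TangentBundle 𝓘(ℝ, E) M → ℝ :=
  fun u => metric F u (φ u) (φ u)

/-- The domain `{F > Φ}` (in the slit tangent bundle). -/
def matsumotoDomain (F : TangentBundle 𝓘(ℝ, E) M → ℝ) (φ : PiField E M) :
    Set (TangentBundle 𝓘(ℝ, E) M) :=
  {u | u ∈ slit E M ∧ bigPhi F φ u < F u}

/-- The changed metric `F² / (F - Φ)`. -/
def matsumoto (F : TangentBundle 𝓘(ℝ, E) M → ℝ) (φ : PiField E M) :
    TangentBundle 𝓘(ℝ, E) M → ℝ :=
  fun u => F u ^ 2 / (F u - bigPhi F φ u)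

/-- The function `F (1 + 2p²) - 3Φ`. -/
def deltaFun (F : TangentBundle 𝓘(ℝ, E) M → ℝ) (φ : PiField E M) :
    TangentBundle 𝓘(ℝ, E) M → ℝ :=
  fun u => F u * (1 + 2 * pSq F φ u) - 3 * bigPhi F φ u

/-- `f₁ = F (4Φ - F) / (F (1 + 2p²) - 3Φ)`. -/
def f₁ (F : TangentBundle 𝓘(ℝ, E) M → ℝ) (φ : PiField E M) :
    TangentBundle 𝓘(ℝ, E) M → ℝ :=
  fun u => F u * (4 * bigPhi F φ u - F u) / deltaFun F φ u

/-- `f₂ = 2F³ / (F (1 + 2p²) - 3Φ)`. -/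
def f₂ (F : TangentBundle 𝓘(ℝ, E) M → ℝ) (φ : PiField E M) :
    TangentBundle 𝓘(ℝ, E) M → ℝ :=
  fun u => 2 * F u ^ 3 / deltaFun F φ u

end FinslerGeom

end

/-! Everything follows from one formula for the geodesic spray of the changed metric: `Ĝ = G - f₁ C
+ f₂ γφ`. A Barthel connection depends only on the vertical derivatives of the spray. In natural
coordinates `(x, y)`, a spray `S` gives `Γ(v₁, v₂) = (v₁, ∂_y S₂ · v₁ - v₂)` and `β w = (w, ½ ∂_y S₂
· w)`. Differentiating the correction `-f₁ y + f₂ φ` in `y` yields `-f₁ J - d_J f₁ ⊗ C + d_J f₂ ⊗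
γφ`. There is no further term, because the vertical Berwald condition says that the components of
`φ` do not depend on `y`. Half of this correction is the change of the horizontal map.

Maximal rank makes the spray unique, so the formula only has to be checked in `i_Ĝ dd_J Ê = -dÊ`,
where `Ê = F⁴ / (2 (F - Φ)²)` is a function of `F` and `Φ`. Concurrency enters through four facts.
The vertical derivative of `Φ` is `d_J Φ(W) = g(φ, ρ W)`, so `γφ · Φ = p²` and `i_{γφ} dd_J E = d_J
Φ`. The form `dd_J Φ` vanishes, since the vertical Cartan condition kills the vertical derivatives
of `g(φ, b)` for constant `b` and the horizontal one makes the remaining part symmetric. Along the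
spray `G · Φ = -F²`. Finally `G · F = 0` and Euler's relation hold for any Finsler metric.

With these, and with Euler's relation for `Ê` as a 2-homogeneous function of `(F, Φ)`, the
difference of the two sides is a combination of `d_J F` and `d_J Φ`. Its two coefficients vanish
when `f₁` and `f₂` solve a linear system, whose solution has the denominator `F (1 + 2p²) - 3Φ`. The
computation on `E × E` is `omega_matsumotoEnergy`, its geometric inputs are `omega_modelPhi` and
`fderiv_modelPhi_spray`, and `HasRep.ddJ_eq`, `dcrd_barthel` and `dcrd_bet` carry the intrinsic
definitions to coordinates. -/

noncomputable section

namespace FinslerGeom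

/-! ### Natural coordinates on `TM`, and vector fields and brackets read in them. -/

section Coordinates

variable {E : Type*} [NormedAddCommGroup E] [NormedSpace ℝ E]
  {M : Type*} [TopologicalSpace M] [ChartedSpace E M] [IsManifold 𝓘(ℝ, E) ∞ M]

/-- The domain of the natural chart of `TM` around `o`. -/
def chartDom (o : TangentBundle 𝓘(ℝ, E) M) : Set (TangentBundle 𝓘(ℝ, E) M) :=
  (extChartAt 𝓘(ℝ, E).tangent o).source

/-- The natural coordinates `(x, y)` on `TM` around `o`. -/
def crd (o : TangentBundle 𝓘(ℝ, E) M) : TangentBundle 𝓘(ℝ, E) M → E × E :=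
  extChartAt 𝓘(ℝ, E).tangent o

/-- The inverse of the natural coordinates. -/
def crdSymm (o : TangentBundle 𝓘(ℝ, E) M) : E × E → TangentBundle 𝓘(ℝ, E) M :=
  (extChartAt 𝓘(ℝ, E).tangent o).symm

/-- The components of tangent vectors of `TM` in the natural coordinates around `o`. -/
def dcrd (o p : TangentBundle 𝓘(ℝ, E) M) : TangentSpace 𝓘(ℝ, E).tangent p →L[ℝ] E × E :=
  mfderiv 𝓘(ℝ, E).tangent 𝓘(ℝ, E × E) (crd o) p

/-- The components of tangent vectors of `M` in the coordinates around `o.proj`. -/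
def bcrd (o p : TangentBundle 𝓘(ℝ, E) M) : TangentSpace 𝓘(ℝ, E) p.proj →L[ℝ] E :=
  mfderiv 𝓘(ℝ, E) 𝓘(ℝ, E) (extChartAt 𝓘(ℝ, E) o.proj) p.proj

variable {o p : TangentBundle 𝓘(ℝ, E) M}

theorem mem_chartDom : p ∈ chartDom o ↔ p.proj ∈ (chartAt E o.proj).source := by
  simp [chartDom]

theorem mem_chartDom_self : o ∈ chartDom o := mem_extChartAt_source o

theorem isOpen_chartDom : IsOpen (chartDom o) := isOpen_extChartAt_source o

theorem chartDom_mem_nhds (hp : p ∈ chartDom o) : chartDom o ∈ nhds p :=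
  isOpen_chartDom.mem_nhds hp

theorem crdSymm_crd (hp : p ∈ chartDom o) : crdSymm o (crd o p) = p :=
  (extChartAt 𝓘(ℝ, E).tangent o).left_inv hp

theorem contMDiffAt_crd (hp : p ∈ chartDom o) :
    ContMDiffAt 𝓘(ℝ, E).tangent 𝓘(ℝ, E × E) ∞ (crd o) p :=
  contMDiffAt_extChartAt' (by simpa [chartDom] using hp)

theorem contMDiffAt_crdSymm (hp : p ∈ chartDom o) :
    ContMDiffAt 𝓘(ℝ, E × E) 𝓘(ℝ, E).tangent ∞ (crdSymm o) (crd o p) :=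
  (contMDiffOn_extChartAt_symm o).contMDiffAt
    (extChartAt_target_mem_nhds' ((extChartAt 𝓘(ℝ, E).tangent o).map_source hp))

theorem mdifferentiableAt_crd (hp : p ∈ chartDom o) :
    MDifferentiableAt 𝓘(ℝ, E).tangent 𝓘(ℝ, E × E) (crd o) p :=
  (contMDiffAt_crd hp).mdifferentiableAt (by simp)

theorem isInvertible_dcrd (hp : p ∈ chartDom o) : (dcrd o p).IsInvertible :=
  isInvertible_mfderiv_extChartAt hp

theorem isInvertible_bcrd (hp : p ∈ chartDom o) : (bcrd o p).IsInvertible :=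
  isInvertible_mfderiv_extChartAt (by simpa [extChartAt_source] using mem_chartDom.1 hp)

/-- The trivialisation of the tangent bundle is given by the derivatives of the transition maps, and
`tangentCoordChange` at the base point is the derivative of the chart of `M`. -/
theorem crd_eq (hp : p ∈ chartDom o) :
    crd o p = (extChartAt 𝓘(ℝ, E) o.proj p.proj, bcrd o p p.snd) := by
  have h := mem_chartDom.1 hp
  have h2 := mfderiv_chartAt_eq_tangentCoordChange (I := 𝓘(ℝ, E)) h
  refine Prod.ext rfl ?_
  have : bcrd o p = tangentCoordChange 𝓘(ℝ, E) p.proj o.proj p.proj := by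
    rw [← h2]; simp [bcrd]; rfl
  rw [this, tangentCoordChange_def]
  rfl

theorem crd_mk (hp : p ∈ chartDom o) (w : E) :
    crd o (⟨p.proj, w⟩ : TangentBundle 𝓘(ℝ, E) M) =
      (extChartAt 𝓘(ℝ, E) o.proj p.proj, bcrd o p w) :=
  crd_eq (o := o) (p := ⟨p.proj, w⟩) (mem_chartDom.2 (mem_chartDom.1 hp))

/-- In coordinates the inclusion of a fibre is the affine map `y ↦ (x, L y)` with `L = bcrd o p`, so
its derivative is `(0, L)`. -/
theorem dcrd_gam (hp : p ∈ chartDom o) (w : TangentSpace 𝓘(ℝ, E) p.proj) :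
    dcrd o p (gam p w) = (0, bcrd o p w) := by
  let y₀ : E := p.snd
  let L : E →L[ℝ] E := bcrd o p
  let i : E → TangentBundle 𝓘(ℝ, E) M := fun y => ⟨p.proj, y⟩
  let j : E → E × E := fun y => (extChartAt 𝓘(ℝ, E) o.proj p.proj, L y)
  have hmem : ∀ y, i y ∈ chartDom o := fun y => mem_chartDom.2 (mem_chartDom.1 hp)
  have hj : ∀ y, crd o (i y) = j y := fun y => crd_mk hp y
  have hi : i = crdSymm o ∘ j := by
    funext y
    rw [Function.comp_apply, ← hj, crdSymm_crd (hmem y)]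
  have hjd : HasFDerivAt j ((0 : E →L[ℝ] E).prod L) y₀ :=
    (hasFDerivAt_const _ _).prodMk L.hasFDerivAt
  have hid : MDifferentiableAt 𝓘(ℝ, E) 𝓘(ℝ, E).tangent i y₀ := by
    have h2 := (contMDiffAt_crdSymm (hmem y₀)).mdifferentiableAt (by simp)
    rw [hj] at h2
    rw [hi]
    exact h2.comp y₀ hjd.differentiableAt.mdifferentiableAt
  have h : mfderiv 𝓘(ℝ, E) 𝓘(ℝ, E × E) (crd o ∘ i) y₀ = _ :=
    mfderiv_comp y₀ (mdifferentiableAt_crd (hmem y₀)) hid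
  have h1 : crd o ∘ i = j := funext hj
  rw [h1, mfderiv_eq_fderiv, hjd.fderiv] at h
  exact (congrArg (fun T : E →L[ℝ] E × E => T w) h).symm

theorem dcrd_fst (hp : p ∈ chartDom o) (v : TangentSpace 𝓘(ℝ, E).tangent p) :
    (dcrd o p v).1 = bcrd o p (rho p v) := by
  have hb : MDifferentiableAt 𝓘(ℝ, E) 𝓘(ℝ, E) (extChartAt 𝓘(ℝ, E) o.proj) p.proj :=
    mdifferentiableAt_extChartAt (mem_chartDom.1 hp)
  have hpr : MDifferentiableAt 𝓘(ℝ, E).tangent 𝓘(ℝ, E)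
      (fun q : TangentBundle 𝓘(ℝ, E) M => q.proj) p :=
    (contMDiff_proj (n := 1) (TangentSpace 𝓘(ℝ, E) : M → Type _)).mdifferentiableAt (by simp)
  have h1 := mfderiv_comp p hb hpr
  have hf : MDifferentiableAt 𝓘(ℝ, E × E) 𝓘(ℝ, E) (Prod.fst : E × E → E) (crd o p) :=
    differentiableAt_fst.mdifferentiableAt
  have h2 := mfderiv_comp p hf (mdifferentiableAt_crd hp)
  have h3 : (Prod.fst : E × E → E) ∘ crd o = (extChartAt 𝓘(ℝ, E) o.proj) ∘
      (fun q : TangentBundle 𝓘(ℝ, E) M => q.proj) := rfl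
  rw [h3, h1, mfderiv_eq_fderiv, fderiv_fst] at h2
  exact (congrArg (fun L => L v) h2).symm

theorem dFun_eq {f : TangentBundle 𝓘(ℝ, E) M → ℝ} {f' : E × E → ℝ} (hp : p ∈ chartDom o)
    (h : f =ᶠ[nhds p] fun q => f' (crd o q)) (hf : DifferentiableAt ℝ f' (crd o p))
    (v : TangentSpace 𝓘(ℝ, E).tangent p) :
    dFun f p v = fderiv ℝ f' (crd o p) (dcrd o p v) := by
  unfold dFun
  have h1 := mfderiv_comp p (g := f') (f := crd o) (I'' := 𝓘(ℝ, ℝ)) hf.mdifferentiableAt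
    (mdifferentiableAt_crd hp)
  rw [h.mfderiv_eq]
  change mfderiv 𝓘(ℝ, E).tangent 𝓘(ℝ, ℝ) (f' ∘ crd o) p v = _
  rw [h1, mfderiv_eq_fderiv]
  rfl

/-- The vector field `V` on `TM` has components `V'` in the coordinates around `o`, near `p`. -/
def HasComps (o : TangentBundle 𝓘(ℝ, E) M) (V : TMField E M) (V' : E × E → E × E)
    (p : TangentBundle 𝓘(ℝ, E) M) : Prop :=
  ∀ᶠ q in nhds p, dcrd o q (V q) = V' (crd o q)

/-- Near `p` each field is the pullback of its components by the chart, and Lie brackets commute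
with pullbacks. -/
theorem dcrd_bracket [CompleteSpace E] {V W : TMField E M} {V' W' : E × E → E × E}
    (hp : p ∈ chartDom o) (hV : HasComps o V V' p) (hW : HasComps o W W' p)
    (hV' : ContDiffAt ℝ 1 V' (crd o p)) (hW' : ContDiffAt ℝ 1 W' (crd o p)) :
    dcrd o p (bracket V W p) =
      fderiv ℝ W' (crd o p) (V' (crd o p)) - fderiv ℝ V' (crd o p) (W' (crd o p)) := by
  have key : ∀ {X : TMField E M} {X' : E × E → E × E}, HasComps o X X' p →
      VectorField.mpullback 𝓘(ℝ, E).tangent 𝓘(ℝ, E × E) (crd o) X' =ᶠ[nhds p] X := by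
    intro X X' hX
    filter_upwards [hX, chartDom_mem_nhds hp] with q hq hqd
    exact (isInvertible_dcrd hqd).inverse_apply_eq.2 hq.symm
  have : IsManifold 𝓘(ℝ, E).tangent (minSmoothness ℝ 2) (TangentBundle 𝓘(ℝ, E) M) := by
    rw [minSmoothness_of_isRCLikeNormedField]; infer_instance
  have md : ∀ {X' : E × E → E × E}, ContDiffAt ℝ 1 X' (crd o p) →
      MDifferentiableAt 𝓘(ℝ, E × E) 𝓘(ℝ, E × E).tangent
        (fun x => (⟨x, X' x⟩ : TangentBundle 𝓘(ℝ, E × E) (E × E))) (crd o p) := fun h =>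
    (contMDiffAt_vectorSpace_iff_contDiffAt.2 h).mdifferentiableAt (by simp)
  have h := VectorField.mpullback_mlieBracket (I := 𝓘(ℝ, E).tangent) (I' := 𝓘(ℝ, E × E))
    (f := crd o) (V := V') (W := W') (x₀ := p) (n := 2) (md hV') (md hW')
    ((contMDiffAt_crd hp).of_le (by norm_cast))
    (by simp)
  rw [Filter.EventuallyEq.mlieBracket_vectorField_eq (key hV) (key hW),
    VectorField.mpullback_apply] at h
  have h2 := (isInvertible_dcrd hp).inverse_apply_eq.1 h
  have h3 : VectorField.mlieBracket 𝓘(ℝ, E × E) V' W' = VectorField.lieBracket ℝ V' W' := by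
    have := VectorField.mlieBracketWithin_eq_lieBracketWithin (𝕜 := ℝ) (V := V') (W := W')
      (s := Set.univ)
    rwa [VectorField.lieBracketWithin_univ] at this
  exact h2.symm.trans (congrFun h3 _)

/-- Near `p`, every vector field on `TM` that is smooth at `p` has smooth components. -/
theorem exists_hasComps_of_contMDiffAt [CompleteSpace E] {V : TMField E M} (hp : p ∈ chartDom o)
    (hV : ContMDiffAt 𝓘(ℝ, E).tangent 𝓘(ℝ, E).tangent.tangent 1
      (fun q => (⟨q, V q⟩ : TangentBundle 𝓘(ℝ, E).tangent (TangentBundle 𝓘(ℝ, E) M))) p) :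
    ∃ V' : E × E → E × E, ContDiffAt ℝ 1 V' (crd o p) ∧ HasComps o V V' p ∧
      V' (crd o p) = dcrd o p (V p) := by
  -- The components are the pullback of `V` by the inverse chart, for which smoothness of
  -- pulled-back vector fields is available.
  let V' : E × E → E × E := VectorField.mpullback 𝓘(ℝ, E × E) 𝓘(ℝ, E).tangent (crdSymm o) V
  have hsymm : ∀ z ∈ (extChartAt 𝓘(ℝ, E).tangent o).target,
      (mfderiv 𝓘(ℝ, E × E) 𝓘(ℝ, E).tangent (crdSymm o) z).IsInvertible := fun z hz => by
    have h := isInvertible_mfderivWithin_extChartAt_symm hz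
    rwa [ModelWithCorners.range_eq_univ, mfderivWithin_univ] at h
  have hV' : ∀ z ∈ (extChartAt 𝓘(ℝ, E).tangent o).target,
      dcrd o (crdSymm o z) (V (crdSymm o z)) = V' z := fun z hz => by
    have h := mfderivWithin_extChartAt_symm_comp_mfderiv_extChartAt hz
    rw [ModelWithCorners.range_eq_univ, mfderivWithin_univ] at h
    exact ((hsymm z hz).inverse_apply_eq.2
      (congrArg (fun T : E × E →L[ℝ] E × E => T (V (crdSymm o z))) h).symm).symm
  have hq : ∀ q ∈ chartDom o, dcrd o q (V q) = V' (crd o q) := fun q hq => by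
    have h := hV' (crd o q) ((extChartAt 𝓘(ℝ, E).tangent o).map_source hq)
    rwa [crdSymm_crd hq] at h
  refine ⟨V', ?_, ?_, (hq p hp).symm⟩
  · refine contMDiffAt_vectorSpace_iff_contDiffAt.1 ?_
    refine ContMDiffAt.mpullback_vectorField_preimage (n := 2) ?_
      ((contMDiffAt_crdSymm hp).of_le (by norm_cast))
      (hsymm _ ((extChartAt 𝓘(ℝ, E).tangent o).map_source hp)) (by norm_num)
    rw [crdSymm_crd hp]
    exact hV
  · filter_upwards [chartDom_mem_nhds hp] with q hqd using hq q hqd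

theorem exists_hasComps_ext [CompleteSpace E] (hp : p ∈ chartDom o)
    (v : TangentSpace 𝓘(ℝ, E).tangent p) :
    ∃ V' : E × E → E × E, ContDiffAt ℝ 1 V' (crd o p) ∧ HasComps o (ext v) V' p ∧
      V' (crd o p) = dcrd o p v := by
  obtain ⟨V', h1, h2, h3⟩ := exists_hasComps_of_contMDiffAt hp (V := ext v)
    (FiberBundle.contMDiffAt_extend _ _ v)
  refine ⟨V', h1, h2, ?_⟩
  rw [h3, ext, FiberBundle.extend_apply_self]

end Coordinates

/-! ### Coordinate expressions of `d_J`, `dd_J`, the metric tensor and `π`-vector fields. -/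

/-- The second derivative of a function on a normed space. -/
def hess {V : Type*} [NormedAddCommGroup V] [NormedSpace ℝ V] (f : V → ℝ) (z : V) :
    V →L[ℝ] V →L[ℝ] ℝ :=
  fderiv ℝ (fderiv ℝ f) z

/-- The form `d d_J f` on `E × E` with its coordinates `(x, y)`. -/
def omega {E : Type*} [NormedAddCommGroup E] [NormedSpace ℝ E] (f : E × E → ℝ) (z v w : E × E) :
    ℝ :=
  hess f z v (0, w.1) - hess f z w (0, v.1)

section Forms

variable {E : Type*} [NormedAddCommGroup E] [NormedSpace ℝ E]
  {M : Type*} [TopologicalSpace M] [ChartedSpace E M] [IsManifold 𝓘(ℝ, E) ∞ M]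

/-- The function `f` on `TM` is represented by `f'` in the coordinates around `o`, near `p`. -/
def HasRep (o : TangentBundle 𝓘(ℝ, E) M) (f : TangentBundle 𝓘(ℝ, E) M → ℝ) (f' : E × E → ℝ)
    (p : TangentBundle 𝓘(ℝ, E) M) : Prop :=
  ∀ᶠ q in nhds p, f q = f' (crd o q)

/-- The `π`-vector field `X` has components `X'` in the coordinates around `o`, near `p`. -/
def HasPiComps (o : TangentBundle 𝓘(ℝ, E) M) (X : PiField E M) (X' : E × E → E)
    (p : TangentBundle 𝓘(ℝ, E) M) : Prop :=
  ∀ᶠ q in nhds p, bcrd o q (X q) = X' (crd o q)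

variable {o p : TangentBundle 𝓘(ℝ, E) M}

theorem tendsto_crd (hp : p ∈ chartDom o) : Filter.Tendsto (crd o) (nhds p) (nhds (crd o p)) :=
  (contMDiffAt_crd hp).continuousAt

theorem dcrd_vertJ (hp : p ∈ chartDom o) (v : TangentSpace 𝓘(ℝ, E).tangent p) :
    dcrd o p (vertJ p v) = (0, (dcrd o p v).1) := by
  rw [dcrd_fst hp]
  exact dcrd_gam hp _

theorem dcrd_injective (hp : p ∈ chartDom o) : Function.Injective (dcrd o p) :=
  (isInvertible_dcrd hp).injective

theorem dcrd_surjective (hp : p ∈ chartDom o) : Function.Surjective (dcrd o p) :=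
  (isInvertible_dcrd hp).surjective

theorem bcrd_injective (hp : p ∈ chartDom o) : Function.Injective (bcrd o p) :=
  (isInvertible_bcrd hp).injective

theorem bcrd_surjective (hp : p ∈ chartDom o) : Function.Surjective (bcrd o p) :=
  (isInvertible_bcrd hp).surjective

theorem rho_surjective (p : TangentBundle 𝓘(ℝ, E) M) : Function.Surjective (rho p) := by
  intro w
  obtain ⟨v, hv⟩ := dcrd_surjective (mem_chartDom_self (o := p)) (bcrd p p w, 0)
  refine ⟨v, bcrd_injective (mem_chartDom_self (o := p)) ?_⟩
  rw [← dcrd_fst mem_chartDom_self, hv]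

theorem HasRep.dFun_eq {f : TangentBundle 𝓘(ℝ, E) M → ℝ} {f' : E × E → ℝ} (hp : p ∈ chartDom o)
    (h : HasRep o f f' p) (hf : DifferentiableAt ℝ f' (crd o p))
    (v : TangentSpace 𝓘(ℝ, E).tangent p) :
    dFun f p v = fderiv ℝ f' (crd o p) (dcrd o p v) :=
  FinslerGeom.dFun_eq hp h hf v

theorem HasRep.dJ_eq {f : TangentBundle 𝓘(ℝ, E) M → ℝ} {f' : E × E → ℝ} (hp : p ∈ chartDom o)
    (h : HasRep o f f' p) (hf : DifferentiableAt ℝ f' (crd o p))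
    (v : TangentSpace 𝓘(ℝ, E).tangent p) :
    dJ f p v = fderiv ℝ f' (crd o p) (0, (dcrd o p v).1) := by
  rw [dJ, h.dFun_eq hp hf, dcrd_vertJ hp]

theorem HasRep.dJ {f : TangentBundle 𝓘(ℝ, E) M → ℝ} {f' : E × E → ℝ} (hp : p ∈ chartDom o)
    (h : HasRep o f f' p) (hf : ContDiffAt ℝ 1 f' (crd o p)) {W : TMField E M}
    {W' : E × E → E × E} (hW : HasComps o W W' p) :
    HasRep o (fun q => dJ f q (W q)) (fun z => fderiv ℝ f' z (0, (W' z).1)) p := by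
  have hf1 := (tendsto_crd hp).eventually (hf.eventually (by simp))
  filter_upwards [h.eventually_nhds, hf1, hW, chartDom_mem_nhds hp] with q h1 h2 h3 h4
  rw [HasRep.dJ_eq h4 h1 (h2.differentiableAt (by simp)), h3]

theorem contDiffAt_fderiv {V G : Type*} [NormedAddCommGroup V] [NormedSpace ℝ V]
    [NormedAddCommGroup G] [NormedSpace ℝ G] {f : V → G} {z : V} (hf : ContDiffAt ℝ ∞ f z) :
    ContDiffAt ℝ ∞ (fderiv ℝ f) z :=
  hf.fderiv_right (by simp)

/-- The terms containing derivatives of the two extensions cancel against `d_J f` of their bracket.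
Only second derivatives of `f'` survive, so the choice of extension does not matter. -/
theorem HasRep.ddJ_eq [CompleteSpace E] {f : TangentBundle 𝓘(ℝ, E) M → ℝ} {f' : E × E → ℝ}
    (hp : p ∈ chartDom o) (h : HasRep o f f' p) (hf : ContDiffAt ℝ ∞ f' (crd o p))
    (v w : TangentSpace 𝓘(ℝ, E).tangent p) :
    ddJ f p v w = omega f' (crd o p) (dcrd o p v) (dcrd o p w) := by
  obtain ⟨V', hV1, hV, hVp⟩ := exists_hasComps_ext hp v
  obtain ⟨W', hW1, hW, hWp⟩ := exists_hasComps_ext hp w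
  have hf1 : ContDiffAt ℝ 1 f' (crd o p) := hf.of_le (by norm_cast)
  have key : ∀ {X' : E × E → E × E}, ContDiffAt ℝ 1 X' (crd o p) →
      HasFDerivAt (fun z => fderiv ℝ f' z (0, (X' z).1))
        ((fderiv ℝ f' (crd o p)).comp (((0 : E × E →L[ℝ] E).prod
          ((ContinuousLinearMap.fst ℝ E E).comp (fderiv ℝ X' (crd o p))))) +
          (hess f' (crd o p)).flip (0, (X' (crd o p)).1)) (crd o p) := by
    intro X' hX
    have hX2 := (hX.differentiableAt (by simp)).hasFDerivAt
    exact (((contDiffAt_fderiv hf).differentiableAt (by simp)).hasFDerivAt).clm_apply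
      ((hasFDerivAt_const _ _).prodMk (hX2.fst))
  rw [ddJ, HasRep.dFun_eq hp (h.dJ hp hf1 hW) (key hW1).differentiableAt,
    HasRep.dFun_eq hp (h.dJ hp hf1 hV) (key hV1).differentiableAt, (key hW1).fderiv,
    (key hV1).fderiv, h.dJ_eq hp (hf1.differentiableAt (by simp)), dcrd_bracket hp hV hW hV1 hW1,
    hVp, hWp]
  have e1 : ∀ a b : E, ((0, a - b) : E × E) = (0, a) - (0, b) := by simp
  simp only [omega, add_apply, ContinuousLinearMap.comp_apply,
    ContinuousLinearMap.prod_apply, zero_apply,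
    ContinuousLinearMap.flip_apply, ContinuousLinearMap.coe_fst', Prod.fst_sub, e1, map_sub]
  ring

theorem metric_eq [CompleteSpace E] {F : TangentBundle 𝓘(ℝ, E) M → ℝ} {e : E × E → ℝ}
    (hp : p ∈ chartDom o) (h : HasRep o (energy F) e p) (he : ContDiffAt ℝ ∞ e (crd o p))
    (w z : TangentSpace 𝓘(ℝ, E) p.proj) :
    metric F p w z = hess e (crd o p) (0, bcrd o p w) (0, bcrd o p z) := by
  have hz : rho p (Function.invFun (rho p) z) = z :=
    Function.invFun_eq (rho_surjective p z)
  rw [metric, h.ddJ_eq hp he, omega, dcrd_gam hp, dcrd_fst hp, hz]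
  -- The second term of `omega` is zero because `γ w` has no `x`-component. Hence the chosen lift of
  -- `z` enters only through its projection.
  exact (congrArg _ (map_zero _)).trans (sub_zero _)

theorem metricFun_hasRep [CompleteSpace E] {F : TangentBundle 𝓘(ℝ, E) M → ℝ} {e : E × E → ℝ}
    (hp : p ∈ chartDom o) (h : HasRep o (energy F) e p)
    (he : ∀ᶠ z in nhds (crd o p), ContDiffAt ℝ ∞ e z)
    {X Y : PiField E M} {X' Y' : E × E → E} (hX : HasPiComps o X X' p)
    (hY : HasPiComps o Y Y' p) :
    HasRep o (metricFun F X Y) (fun z => hess e z (0, X' z) (0, Y' z)) p := by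
  filter_upwards [h.eventually_nhds, (tendsto_crd hp).eventually he, hX, hY,
    chartDom_mem_nhds hp] with q h1 h2 h3 h4 h5
  rw [metricFun, metric_eq h5 h1 h2, h3, h4]

theorem vert_hasComps {X : PiField E M} {X' : E × E → E} (hp : p ∈ chartDom o)
    (hX : HasPiComps o X X' p) : HasComps o (vert X) (fun z => (0, X' z)) p := by
  filter_upwards [hX, chartDom_mem_nhds hp] with q h3 h5
  rw [vert, dcrd_gam h5, h3]

theorem eta_hasPiComps (hp : p ∈ chartDom o) :
    HasPiComps (E := E) (M := M) o (fun q => q.snd) (fun z => z.2) p := by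
  filter_upwards [chartDom_mem_nhds hp] with q h5
  rw [crd_eq h5]

theorem eta_piSmoothAt : PiSmoothAt (E := E) (M := M) (fun q => q.snd) p := contMDiffAt_id

theorem liouville_hasComps (hp : p ∈ chartDom o) :
    HasComps (E := E) (M := M) o liouville (fun z => (0, z.2)) p :=
  vert_hasComps hp (eta_hasPiComps hp)

/-- The domain of the inverse of the coordinates, without the zero section. -/
def slitTarget (o : TangentBundle 𝓘(ℝ, E) M) : Set (E × E) :=
  {z | z ∈ (extChartAt 𝓘(ℝ, E).tangent o).target ∧ z.2 ≠ 0}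

theorem isOpen_slitTarget : IsOpen (slitTarget o) :=
  (isOpen_extChartAt_target o).inter (isOpen_ne.preimage continuous_snd)

theorem crdSymm_mem {z : E × E} (hz : z ∈ (extChartAt 𝓘(ℝ, E).tangent o).target) :
    crdSymm o z ∈ chartDom o := (extChartAt 𝓘(ℝ, E).tangent o).map_target hz

theorem crd_crdSymm {z : E × E} (hz : z ∈ (extChartAt 𝓘(ℝ, E).tangent o).target) :
    crd o (crdSymm o z) = z := (extChartAt 𝓘(ℝ, E).tangent o).right_inv hz

theorem crd_mem_slitTarget (hp : p ∈ chartDom o) : crd o p ∈ slitTarget o ↔ p ∈ slit E M := by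
  have h : (crd o p).2 = bcrd o p p.snd := by rw [crd_eq hp]
  have h2 : (bcrd o p p.snd = 0) ↔ p.snd = 0 := by
    constructor
    · intro h; exact bcrd_injective hp (h.trans (map_zero _).symm)
    · intro h; rw [h, map_zero]
  rw [slitTarget, Set.mem_ofPred_eq, h, ne_eq, h2, slit, Set.mem_ofPred_eq]
  exact and_iff_right ((extChartAt 𝓘(ℝ, E).tangent o).map_source hp)

theorem isOpen_slit : IsOpen (slit E M) := by
  rw [isOpen_iff_mem_nhds]
  intro p hp
  have h := mem_chartDom_self (o := p)
  filter_upwards [chartDom_mem_nhds h, (tendsto_crd h).eventually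
    (isOpen_slitTarget.mem_nhds ((crd_mem_slitTarget h).2 hp))] with q h1 h2
  exact (crd_mem_slitTarget h1).1 h2

theorem hasRep_comp_crdSymm (f : TangentBundle 𝓘(ℝ, E) M → ℝ) (hp : p ∈ chartDom o) :
    HasRep o f (fun z => f (crdSymm o z)) p := by
  filter_upwards [chartDom_mem_nhds hp] with q h5
  rw [crdSymm_crd h5]

theorem contDiffAt_comp_crdSymm {f : TangentBundle 𝓘(ℝ, E) M → ℝ} (hp : p ∈ chartDom o)
    (hf : ContMDiffAt 𝓘(ℝ, E).tangent 𝓘(ℝ, ℝ) ∞ f p) :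
    ContDiffAt ℝ ∞ (fun z => f (crdSymm o z)) (crd o p) := by
  rw [← contMDiffAt_iff_contDiffAt]
  refine ContMDiffAt.comp (g := f) (f := crdSymm o) _ ?_ (contMDiffAt_crdSymm hp)
  rwa [crdSymm_crd hp]

/-- The components of a `π`-vector field in the coordinates around `o`. -/
def piComps (o : TangentBundle 𝓘(ℝ, E) M) (X : PiField E M) (z : E × E) : E :=
  bcrd o (crdSymm o z) (X (crdSymm o z))

theorem hasPiComps_piComps (X : PiField E M) (hp : p ∈ chartDom o) :
    HasPiComps o X (piComps o X) p := by
  filter_upwards [chartDom_mem_nhds hp] with q h5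
  rw [piComps, crdSymm_crd h5]

theorem contDiffAt_piComps {X : PiField E M} (hp : p ∈ chartDom o) (hX : PiSmoothAt X p) :
    ContDiffAt ℝ ∞ (piComps o X) (crd o p) := by
  have hpX : (⟨p.proj, X p⟩ : TangentBundle 𝓘(ℝ, E) M) ∈ chartDom o :=
    mem_chartDom.2 (mem_chartDom.1 hp)
  have h1 : ContMDiffAt 𝓘(ℝ, E × E) 𝓘(ℝ, E × E) ∞
      (fun z => crd o (⟨(crdSymm o z).proj, X (crdSymm o z)⟩ : TangentBundle 𝓘(ℝ, E) M))
      (crd o p) := by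
    refine ContMDiffAt.comp (I' := 𝓘(ℝ, E).tangent)
      (g := fun q => crd o (⟨q.proj, X q⟩ : TangentBundle 𝓘(ℝ, E) M))
      (f := crdSymm o) _ ?_ (contMDiffAt_crdSymm hp)
    rw [crdSymm_crd hp]
    exact ContMDiffAt.comp (I' := 𝓘(ℝ, E).tangent) p (contMDiffAt_crd hpX) hX
  have h2 := (contMDiffAt_iff_contDiffAt.1 h1).snd
  refine h2.congr_of_eventuallyEq ?_
  filter_upwards [extChartAt_target_mem_nhds'
    ((extChartAt 𝓘(ℝ, E).tangent o).map_source hp)] with z hz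
  exact congrArg Prod.snd (crd_mk (crdSymm_mem hz) _).symm

/-- Supplies the test fields for the connection identities: with constant components, every term
that differentiates the test field drops out. -/
theorem exists_constant_piField (hp : p ∈ chartDom o) (b : E) :
    ∃ Z : PiField E M, PiSmoothAt Z p ∧ HasPiComps o Z (fun _ => b) p := by
  have hmem : ∀ q ∈ chartDom o, ((crd o q).1, b) ∈ (extChartAt 𝓘(ℝ, E).tangent o).target := by
    intro q hq
    obtain ⟨w, hw⟩ := bcrd_surjective hq b
    have h1 := crd_mk hq w
    have h2 : (⟨q.proj, w⟩ : TangentBundle 𝓘(ℝ, E) M) ∈ chartDom o :=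
      mem_chartDom.2 (mem_chartDom.1 hq)
    have h3 := (extChartAt 𝓘(ℝ, E).tangent o).map_source h2
    change crd o _ ∈ _ at h3
    rw [h1, hw] at h3
    exact h3
  let Z : PiField E M := fun q => (bcrd o q).inverse b
  have hZ : ∀ q ∈ chartDom o, bcrd o q (Z q) = b := fun q hq =>
    (isInvertible_bcrd hq).self_apply_inverse b
  refine ⟨Z, ?_, ?_⟩
  · have h1 : ContMDiffAt 𝓘(ℝ, E).tangent 𝓘(ℝ, E).tangent ∞
        (fun q => crdSymm o ((crd o q).1, b)) p := by
      have h2 : ContMDiffAt 𝓘(ℝ, E).tangent 𝓘(ℝ, E × E) ∞ (fun q => ((crd o q).1, b)) p := by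
        have h3 : ContDiff ℝ ∞ (fun z : E × E => (z.1, b)) := contDiff_fst.prodMk contDiff_const
        exact ContMDiffAt.comp p h3.contMDiff.contMDiffAt (contMDiffAt_crd hp)
      refine ContMDiffAt.comp (I' := 𝓘(ℝ, E × E)) p ?_ h2
      exact (contMDiffOn_extChartAt_symm o).contMDiffAt
        (extChartAt_target_mem_nhds' (hmem p hp))
    refine h1.congr_of_eventuallyEq ?_
    filter_upwards [chartDom_mem_nhds hp] with q hq
    have h2 := crd_mk hq (Z q)
    have h3 : (⟨q.proj, Z q⟩ : TangentBundle 𝓘(ℝ, E) M) ∈ chartDom o :=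
      mem_chartDom.2 (mem_chartDom.1 hq)
    rw [hZ q hq] at h2
    rw [← crdSymm_crd h3]
    exact congrArg (crdSymm o) h2
  · filter_upwards [chartDom_mem_nhds hp] with q hq using hZ q hq

end Forms

/-! ### The spray of an energy on `E × E`. -/

section ModelSpray

variable {E : Type*} [NormedAddCommGroup E] [NormedSpace ℝ E] {e : E × E → ℝ} {z : E × E}

theorem hess_symm (he : ContDiffAt ℝ ∞ e z) (v w : E × E) : hess e z v w = hess e z w v :=
  (he.isSymmSndFDerivAt (by simp; norm_cast)).eq v w

theorem contDiffAt_hess (he : ContDiffAt ℝ ∞ e z) : ContDiffAt ℝ ∞ (hess e) z :=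
  contDiffAt_fderiv (contDiffAt_fderiv he)

theorem hasFDerivAt_fderiv_apply (he : ContDiffAt ℝ ∞ e z) {X : E × E → E × E}
    {X' : E × E →L[ℝ] E × E} (hX : HasFDerivAt X X' z) :
    HasFDerivAt (fun z => fderiv ℝ e z (X z))
      ((fderiv ℝ e z).comp X' + (hess e z).flip (X z)) z :=
  ((contDiffAt_fderiv he).differentiableAt (by simp)).hasFDerivAt.clm_apply hX

/-- The derivative of Euler's relation for a fibrewise `2`-homogeneous function. -/
theorem hess_apply_eta (he : ContDiffAt ℝ ∞ e z)
    (hom : ∀ᶠ z in nhds z, fderiv ℝ e z (0, z.2) = 2 * e z) (v : E × E) :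
    hess e z v (0, z.2) = 2 * fderiv ℝ e z v - fderiv ℝ e z (0, v.2) := by
  have h1 := hasFDerivAt_fderiv_apply he
    ((hasFDerivAt_const (0 : E) z).prodMk (hasFDerivAt_snd (𝕜 := ℝ) (E := E) (F := E)))
  have h2 : HasFDerivAt (fun z => 2 * e z) ((2 : ℝ) • fderiv ℝ e z) z :=
    (he.differentiableAt (by simp)).hasFDerivAt.const_mul 2
  have h3 := h1.unique (h2.congr_of_eventuallyEq hom)
  have h4 := congrArg (fun L => L v) h3
  simp at h4
  linarith

/-- The bilinear form `omega` as a continuous linear map. -/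
def omegaCLM (e : E × E → ℝ) (z : E × E) : E × E →L[ℝ] E × E →L[ℝ] ℝ :=
  let i : E × E →L[ℝ] E × E := (0 : E × E →L[ℝ] E).prod (ContinuousLinearMap.fst ℝ E E)
  ((ContinuousLinearMap.compL ℝ (E × E) (E × E) ℝ).flip i).comp (hess e z) - (hess e z).comp i

theorem omegaCLM_apply (he : ContDiffAt ℝ ∞ e z) (v w : E × E) :
    omegaCLM e z v w = omega e z v w := by
  simp [omegaCLM, omega, hess_symm he w]

theorem contDiffAt_omegaCLM (he : ContDiffAt ℝ ∞ e z) : ContDiffAt ℝ ∞ (omegaCLM e) z :=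
  (contDiffAt_const.clm_comp (contDiffAt_hess he)).sub
    ((contDiffAt_hess he).clm_comp contDiffAt_const)

/-- The solution `S` of `i_S d d_J e = - d e` on `E × E`. -/
def modelSpray (e : E × E → ℝ) (z : E × E) : E × E := (omegaCLM e z).inverse (-fderiv ℝ e z)

variable [FiniteDimensional ℝ E]

/-- Nondegeneracy is injectivity of `E × E → (E × E)*`, and the two spaces have the same finite
dimension. -/
theorem isInvertible_omegaCLM (he : ContDiffAt ℝ ∞ e z)
    (hr : ∀ v, (∀ w, omega e z v w = 0) → v = 0) :
    (omegaCLM e z).IsInvertible := by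
  have hinj : Function.Injective (omegaCLM e z) := by
    rw [injective_iff_map_eq_zero]
    intro v hv
    refine hr v fun w => ?_
    rw [← omegaCLM_apply he, hv]
    rfl
  have hdim : Module.finrank ℝ (E × E) = Module.finrank ℝ (E × E →L[ℝ] ℝ) := by
    rw [← (LinearMap.toContinuousLinearMap (𝕜 := ℝ) (E := E × E) (F' := ℝ)).finrank_eq]
    exact (Subspace.dual_finrank_eq (K := ℝ) (V := E × E)).symm
  let T : (E × E) ≃ₗ[ℝ] (E × E →L[ℝ] ℝ) :=
    LinearEquiv.ofInjectiveOfFinrankEq ((omegaCLM e z : _ →ₗ[ℝ] _)) hinj hdim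
  exact ⟨T.toContinuousLinearEquiv, ContinuousLinearMap.ext fun _ => rfl⟩

theorem omega_modelSpray (he : ContDiffAt ℝ ∞ e z)
    (hr : ∀ v, (∀ w, omega e z v w = 0) → v = 0) (w : E × E) :
    omega e z (modelSpray e z) w = -fderiv ℝ e z w := by
  rw [← omegaCLM_apply he, modelSpray, (isInvertible_omegaCLM he hr).self_apply_inverse]
  rfl

/-- Inversion of continuous linear maps is smooth at an invertible one, so solving a smoothly
varying linear equation gives a smooth solution. -/
theorem contDiffAt_modelSpray (he : ContDiffAt ℝ ∞ e z)
    (hr : ∀ v, (∀ w, omega e z v w = 0) → v = 0) : ContDiffAt ℝ ∞ (modelSpray e) z := by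
  have h1 := (isInvertible_omegaCLM he hr).contDiffAt_map_inverse (n := ∞)
  exact (h1.comp z (contDiffAt_omegaCLM he)).clm_apply (contDiffAt_fderiv he).neg

theorem modelSpray_fst (he : ContDiffAt ℝ ∞ e z)
    (hr : ∀ v, (∀ w, omega e z v w = 0) → v = 0)
    (hom : ∀ᶠ z in nhds z, fderiv ℝ e z (0, z.2) = 2 * e z) : (modelSpray e z).1 = z.2 := by
  -- This is `J S = C`: the vertical vector `(0, S₁ - y)` lies in the kernel of `omega`, by the
  -- spray equation on vertical vectors and Euler's relation.
  have h0 : ((0, (modelSpray e z).1 - z.2) : E × E) = 0 := by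
    refine hr _ fun w => ?_
    have h1 := omega_modelSpray he hr (0, w.1)
    have h2 := hess_apply_eta he hom (0, w.1)
    have e1 : ∀ a b : E, ((0, a - b) : E × E) = (0, a) - (0, b) := by simp
    simp only [omega, Prod.mk_zero_zero, map_zero, zero_sub, sub_zero] at h1 ⊢
    rw [e1, map_sub, sub_apply, hess_symm he, hess_symm he (0, z.2), h2]
    linarith
  exact sub_eq_zero.1 (congrArg Prod.snd h0)

end ModelSpray

/-! ### The Barthel connection and the horizontal map in coordinates. -/

section Barthel

variable {E : Type*} [NormedAddCommGroup E] [NormedSpace ℝ E]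
  {M : Type*} [TopologicalSpace M] [ChartedSpace E M] [IsManifold 𝓘(ℝ, E) ∞ M]
  {o p : TangentBundle 𝓘(ℝ, E) M} {F : TangentBundle 𝓘(ℝ, E) M → ℝ} {e : E × E → ℝ}

theorem MaxRankAt.omega_eq_zero [CompleteSpace E] (hr : MaxRankAt F p) (hp : p ∈ chartDom o)
    (h : HasRep o (energy F) e p) (he : ContDiffAt ℝ ∞ e (crd o p)) (v : E × E)
    (hv : ∀ w, omega e (crd o p) v w = 0) : v = 0 := by
  obtain ⟨v, rfl⟩ := dcrd_surjective hp v
  rw [hr v fun w => ?_, map_zero]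
  rw [h.ddJ_eq hp he, hv]

/-- The spray is determined by its defining equation, read in coordinates. -/
theorem MaxRankAt.spray_eq [CompleteSpace E] (hr : MaxRankAt F p) (hp : p ∈ chartDom o)
    (h : HasRep o (energy F) e p) (he : ContDiffAt ℝ ∞ e (crd o p))
    {ξ : TangentSpace 𝓘(ℝ, E).tangent p}
    (hξ : ∀ w, omega e (crd o p) (dcrd o p ξ) w = -fderiv ℝ e (crd o p) w) :
    spray F p = ξ := by
  have hd := he.differentiableAt (by simp)
  have h1 : ∀ w, ddJ (energy F) p ξ w = -dFun (energy F) p w := fun w => by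
    rw [h.ddJ_eq hp he, hξ, h.dFun_eq hp hd]
  have h2 : ∀ w, ddJ (energy F) p (spray F p) w = -dFun (energy F) p w :=
    Classical.epsilon_spec (p := fun ξ : TangentSpace 𝓘(ℝ, E).tangent p =>
      ∀ w, ddJ (energy F) p ξ w = - dFun (energy F) p w) ⟨ξ, h1⟩
  -- Two solutions of the spray equation differ by a vector in the kernel of `dd_J E`.
  refine sub_eq_zero.1 (hr _ fun w => ?_)
  have h3 := (h2 w).trans (h1 w).symm
  rw [h.ddJ_eq hp he] at h3 ⊢
  rw [h.ddJ_eq hp he] at h3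
  rw [← omegaCLM_apply he] at h3 ⊢
  rw [← omegaCLM_apply he] at h3
  rw [map_sub, map_sub, sub_apply, h3, sub_self]

variable {S : E × E → E × E}

/-- The Barthel connection in coordinates. -/
theorem dcrd_barthel [CompleteSpace E] (hp : p ∈ chartDom o) (hS : HasComps o (spray F) S p)
    (hSd : ContDiffAt ℝ 1 S (crd o p)) (hS1 : ∀ᶠ z in nhds (crd o p), (S z).1 = z.2)
    (v : TangentSpace 𝓘(ℝ, E).tangent p) :
    dcrd o p (barthel F p v) = ((dcrd o p v).1,
      (fderiv ℝ S (crd o p) (0, (dcrd o p v).1)).2 - (dcrd o p v).2) := by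
  obtain ⟨V', hV1, hV, hVp⟩ := exists_hasComps_ext hp v
  have hJ : HasComps o (fun q => vertJ q (ext v q)) (fun z => (0, (V' z).1)) p := by
    filter_upwards [hV, chartDom_mem_nhds hp] with q h1 h2
    rw [dcrd_vertJ h2, h1]
  have hJ1 : ContDiffAt ℝ 1 (fun z => ((0 : E), (V' z).1)) (crd o p) :=
    contDiffAt_const.prodMk hV1.fst
  have hVd := (hV1.differentiableAt (by simp)).hasFDerivAt
  have hJd : HasFDerivAt (fun z => ((0 : E), (V' z).1)) ((0 : E × E →L[ℝ] E).prod
      ((ContinuousLinearMap.fst ℝ E E).comp (fderiv ℝ V' (crd o p)))) (crd o p) :=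
    (hasFDerivAt_const _ _).prodMk hVd.fst
  -- Since `S₁ = y` near the point, the first component of every derivative of `S` is known.
  have hfst : ∀ u, (fderiv ℝ S (crd o p) u).1 = u.2 := fun u => by
    have h1 := (hSd.differentiableAt (by simp)).hasFDerivAt.fst
    have h2 := h1.unique ((hasFDerivAt_snd (𝕜 := ℝ)).congr_of_eventuallyEq hS1)
    exact congrArg (fun L => L u) h2
  rw [barthel, map_sub, dcrd_vertJ hp, dcrd_bracket hp hV hS hV1 hSd,
    dcrd_bracket hp hJ hS hJ1 hSd, hJd.fderiv, hVp]
  refine Prod.ext ?_ ?_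
  · simp [hfst]
  · simp [hfst]

theorem dcrd_vProj [CompleteSpace E] (hp : p ∈ chartDom o) (hS : HasComps o (spray F) S p)
    (hSd : ContDiffAt ℝ 1 S (crd o p)) (hS1 : ∀ᶠ z in nhds (crd o p), (S z).1 = z.2)
    (v : TangentSpace 𝓘(ℝ, E).tangent p) :
    dcrd o p (vProj F p v) = (0,
      (dcrd o p v).2 - (1 / 2 : ℝ) • (fderiv ℝ S (crd o p) (0, (dcrd o p v).1)).2) := by
  rw [vProj, map_smul, map_sub, dcrd_barthel hp hS hSd hS1]
  refine Prod.ext ?_ ?_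
  · simp
  · simp only [Prod.smul_snd, Prod.snd_sub]
    module

/-- The components of the horizontal lift determined by a spray with components `S`. -/
def modelHor (S : E × E → E × E) (z : E × E) (w : E) : E × E :=
  (w, (1 / 2 : ℝ) • (fderiv ℝ S z (0, w)).2)

/-- The horizontal map in coordinates. -/
theorem dcrd_bet [CompleteSpace E] (hp : p ∈ chartDom o) (hS : HasComps o (spray F) S p)
    (hSd : ContDiffAt ℝ 1 S (crd o p)) (hS1 : ∀ᶠ z in nhds (crd o p), (S z).1 = z.2)
    (w : TangentSpace 𝓘(ℝ, E) p.proj) :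
    dcrd o p (bet F p w) = modelHor S (crd o p) (bcrd o p w) := by
  have hv := dcrd_vProj hp hS hSd hS1
  -- `bet` is a chosen preimage, so a horizontal lift must be exhibited before the choice can be
  -- used. The equation `v = 0` for the projector then determines the lift.
  have hex : ∃ v ∈ horSpace F p, rho p v = w := by
    obtain ⟨v, hv'⟩ := dcrd_surjective hp (modelHor S (crd o p) (bcrd o p w))
    refine ⟨v, dcrd_injective hp ?_, bcrd_injective hp ?_⟩
    · rw [hv, hv', map_zero]
      simp [modelHor]
    · rw [← dcrd_fst hp, hv']
      rfl
  have h1 : bet F p w ∈ horSpace F p := Function.invFunOn_mem hex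
  have h2 : rho p (bet F p w) = w := Function.invFunOn_eq hex
  have h3 : (dcrd o p (bet F p w)).1 = bcrd o p w := by rw [dcrd_fst hp, h2]
  have h4 : dcrd o p (vProj F p (bet F p w)) = 0 := (congrArg _ h1).trans (map_zero _)
  rw [hv, h3] at h4
  exact Prod.ext h3 (sub_eq_zero.1 (congrArg Prod.snd h4))

end Barthel

/-! ### Energies and concurrent fields on `E × E`. -/

section Model

variable {E : Type*} [NormedAddCommGroup E] [NormedSpace ℝ E]

/-- The metric tensor of the energy `e` in coordinates. -/
def modelMetric (e : E × E → ℝ) (z : E × E) (a b : E) : ℝ := hess e z (0, a) (0, b)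

/-- The energy `e` is, on the open set `U`, smooth, fibrewise `2`-homogeneous and
non-degenerate. -/
structure IsModelEnergy (e : E × E → ℝ) (U : Set (E × E)) : Prop where
  isOpen : IsOpen U
  smooth : ∀ z ∈ U, ContDiffAt ℝ ∞ e z
  homogeneous : ∀ z ∈ U, fderiv ℝ e z (0, z.2) = 2 * e z
  nondegenerate : ∀ z ∈ U, ∀ v, (∀ w, omega e z v w = 0) → v = 0

/-- The conditions on a concurrent `π`-vector field, in coordinates. -/
structure IsModelConcurrent (e : E × E → ℝ) (φ : E × E → E) (U : Set (E × E)) : Prop where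
  smooth : ∀ z ∈ U, ContDiffAt ℝ ∞ φ z
  fderiv_vert : ∀ z ∈ U, ∀ w, fderiv ℝ φ z (0, w) = 0
  metric_vert : ∀ z ∈ U, ∀ a b, fderiv ℝ (fun z => modelMetric e z (φ z) b) z (0, a) = 0
  metric_hor : ∀ z ∈ U, ∀ a b,
    fderiv ℝ (fun z => modelMetric e z (φ z) b) z (modelHor (modelSpray e) z a) =
      fderiv ℝ (fun z => modelMetric e z (φ z) a) z (modelHor (modelSpray e) z b)
  metric_eta : ∀ z ∈ U,
    fderiv ℝ (fun z => modelMetric e z z.2 z.2) z (modelHor (modelSpray e) z (φ z))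
      + 2 * modelMetric e z z.2 (fderiv ℝ φ z (modelHor (modelSpray e) z z.2)
          - (modelHor (modelSpray e) z (φ z)).2) = -(2 * modelMetric e z z.2 z.2)

variable {e : E × E → ℝ} {U : Set (E × E)} {z : E × E}

namespace IsModelEnergy

theorem eventually_mem (he : IsModelEnergy e U) (hz : z ∈ U) : ∀ᶠ z in nhds z, z ∈ U :=
  he.isOpen.mem_nhds hz

theorem hess_eta (he : IsModelEnergy e U) (hz : z ∈ U) (v : E × E) :
    hess e z v (0, z.2) = 2 * fderiv ℝ e z v - fderiv ℝ e z (0, v.2) :=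
  hess_apply_eta (he.smooth z hz)
    ((he.eventually_mem hz).mono fun z hz => he.homogeneous z hz) v

theorem metric_eta_left (he : IsModelEnergy e U) (hz : z ∈ U) (w : E) :
    modelMetric e z z.2 w = fderiv ℝ e z (0, w) := by
  rw [modelMetric, hess_symm (he.smooth z hz), he.hess_eta hz]
  ring

theorem metric_eta_right (he : IsModelEnergy e U) (hz : z ∈ U) (w : E) :
    modelMetric e z w z.2 = fderiv ℝ e z (0, w) := by
  rw [modelMetric, he.hess_eta hz]
  ring

variable [FiniteDimensional ℝ E]

theorem spray_fst (he : IsModelEnergy e U) (hz : z ∈ U) : (modelSpray e z).1 = z.2 :=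
  modelSpray_fst (he.smooth z hz) (he.nondegenerate z hz)
    ((he.eventually_mem hz).mono fun z hz => he.homogeneous z hz)

theorem omega_spray (he : IsModelEnergy e U) (hz : z ∈ U) (w : E × E) :
    omega e z (modelSpray e z) w = -fderiv ℝ e z w :=
  omega_modelSpray (he.smooth z hz) (he.nondegenerate z hz) w

theorem contDiffAt_spray (he : IsModelEnergy e U) (hz : z ∈ U) :
    ContDiffAt ℝ ∞ (modelSpray e) z :=
  contDiffAt_modelSpray (he.smooth z hz) (he.nondegenerate z hz)

theorem fderiv_spray (he : IsModelEnergy e U) (hz : z ∈ U) :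
    fderiv ℝ e z (modelSpray e z) = 0 := by
  have h := he.omega_spray hz (modelSpray e z)
  rw [omega, sub_self] at h
  linarith

/-- The spray equation tested on `(w, 0)`, with Euler's relation evaluating the other Hessian term.
It is the Euler–Lagrange equation of the energy. -/
theorem hess_spray (he : IsModelEnergy e U) (hz : z ∈ U) (w : E) :
    hess e z (modelSpray e z) (0, w) = fderiv ℝ e z (w, 0) := by
  have h := he.omega_spray hz (w, 0)
  rw [omega, he.spray_fst hz, he.hess_eta hz] at h
  simp only [Prod.mk_zero_zero, map_zero] at h
  linarith

/-- The energy is constant in horizontal directions. -/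
theorem fderiv_hor (he : IsModelEnergy e U) (hz : z ∈ U) (w : E) :
    fderiv ℝ e z (modelHor (modelSpray e) z w) = 0 := by
  have hS := ((he.contDiffAt_spray hz).differentiableAt (by simp)).hasFDerivAt
  have h1 := hasFDerivAt_fderiv_apply (he.smooth z hz) hS
  have h2 := h1.unique ((hasFDerivAt_const (0 : ℝ) z).congr_of_eventuallyEq
    ((he.eventually_mem hz).mono fun z hz => he.fderiv_spray hz))
  -- The vertical derivative of the identity `dE(S) = 0`. Its Hessian term equals `dE(w, 0)` by the
  -- Euler–Lagrange equation, so `dE` kills `∂_w S + (w, 0)`, which is twice the horizontal lift of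
  -- `w`.
  have h3 := congrArg (fun L => L (0, w)) h2
  have h4 : (fderiv ℝ (modelSpray e) z (0, w)).1 = w := by
    have h5 := hS.fst.unique ((hasFDerivAt_snd (𝕜 := ℝ)).congr_of_eventuallyEq
      ((he.eventually_mem hz).mono fun z hz => he.spray_fst hz))
    exact congrArg (fun L => L (0, w)) h5
  have h6 : modelHor (modelSpray e) z w =
      (1 / 2 : ℝ) • (fderiv ℝ (modelSpray e) z (0, w) + (w, 0)) := by
    refine Prod.ext ?_ ?_
    · simp only [modelHor, Prod.smul_fst, Prod.fst_add, h4]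
      module
    · simp [modelHor]
  simp only [add_apply, ContinuousLinearMap.comp_apply, ContinuousLinearMap.flip_apply,
    zero_apply, hess_symm (he.smooth z hz) (0, w), he.hess_spray hz] at h3
  rw [h6, map_smul, map_add, h3, smul_zero]

end IsModelEnergy

/-- The function `Φ` in coordinates. -/
def modelPhi (e : E × E → ℝ) (φ : E × E → E) (z : E × E) : ℝ := modelMetric e z (φ z) z.2

namespace IsModelConcurrent

variable {φ : E × E → E}

theorem modelPhi_eventuallyEq (he : IsModelEnergy e U) (hz : z ∈ U) :
    modelPhi e φ =ᶠ[nhds z] fun z => fderiv ℝ e z (0, φ z) :=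
  (he.eventually_mem hz).mono fun z hz => he.metric_eta_right hz (φ z)

theorem contDiffAt_modelPhi (hφ : IsModelConcurrent e φ U) (he : IsModelEnergy e U)
    (hz : z ∈ U) : ContDiffAt ℝ ∞ (modelPhi e φ) z :=
  ((contDiffAt_fderiv (he.smooth z hz)).clm_apply
    (contDiffAt_const.prodMk (hφ.smooth z hz))).congr_of_eventuallyEq
    (modelPhi_eventuallyEq he hz)

theorem contDiffAt_metric (hφ : IsModelConcurrent e φ U) (he : IsModelEnergy e U)
    (hz : z ∈ U) {X : E × E → E} (hX : ContDiffAt ℝ ∞ X z) :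
    ContDiffAt ℝ ∞ (fun z => modelMetric e z (φ z) (X z)) z :=
  ((contDiffAt_hess (he.smooth z hz)).clm_apply
    (contDiffAt_const.prodMk (hφ.smooth z hz))).clm_apply (contDiffAt_const.prodMk hX)

theorem fderiv_modelPhi (hφ : IsModelConcurrent e φ U) (he : IsModelEnergy e U)
    (hz : z ∈ U) (v : E × E) :
    fderiv ℝ (modelPhi e φ) z v = hess e z v (0, φ z) + fderiv ℝ e z (0, fderiv ℝ φ z v) := by
  have h1 := hasFDerivAt_fderiv_apply (he.smooth z hz)
    ((hasFDerivAt_const (0 : E) z).prodMk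
      ((hφ.smooth z hz).differentiableAt (by simp)).hasFDerivAt)
  rw [(h1.congr_of_eventuallyEq (modelPhi_eventuallyEq he hz)).fderiv]
  simp [add_comm]

/-- `Φ = dE(0, φ)` by Euler's relation, and `φ` is independent of `y`, so only the vertical Hessian
of the energy remains. -/
theorem fderiv_modelPhi_vert (hφ : IsModelConcurrent e φ U) (he : IsModelEnergy e U)
    (hz : z ∈ U) (w : E) :
    fderiv ℝ (modelPhi e φ) z (0, w) = modelMetric e z (φ z) w := by
  rw [hφ.fderiv_modelPhi he hz, hφ.fderiv_vert z hz, Prod.mk_zero_zero, map_zero, add_zero,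
    hess_symm (he.smooth z hz), modelMetric]

/-- Differentiating `∂_b Φ = g(φ, b)` along `v`: the vertical part of `v` contributes nothing by the
vertical Cartan condition. Thus symmetry of the horizontal derivatives is all that `dd_J Φ = 0`
still requires. -/
theorem hess_modelPhi (hφ : IsModelConcurrent e φ U) (he : IsModelEnergy e U)
    (hz : z ∈ U) (v : E × E) (b : E) :
    hess (modelPhi e φ) z v (0, b) =
      fderiv ℝ (fun z => modelMetric e z (φ z) b) z (modelHor (modelSpray e) z v.1) := by
  have h1 := hasFDerivAt_fderiv_apply (hφ.contDiffAt_modelPhi he hz)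
    (hasFDerivAt_const ((0, b) : E × E) z)
  have h2 : (fun z => fderiv ℝ (modelPhi e φ) z (0, b)) =ᶠ[nhds z]
      fun z => modelMetric e z (φ z) b :=
    (he.eventually_mem hz).mono fun z hz => hφ.fderiv_modelPhi_vert he hz b
  have h3 : v = modelHor (modelSpray e) z v.1 + (0, v.2 - (modelHor (modelSpray e) z v.1).2) := by
    refine Prod.ext ?_ ?_ <;> simp [modelHor]
  have h4 := (h1.congr_of_eventuallyEq h2.symm).fderiv
  have h5 : fderiv ℝ (fun z => modelMetric e z (φ z) b) z v = hess (modelPhi e φ) z v (0, b) := by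
    rw [h4]; simp
  rw [← h5]
  conv_lhs => rw [h3]
  rw [map_add, hφ.metric_vert z hz, add_zero]

/-- The form `d d_J Φ` vanishes. -/
theorem omega_modelPhi (hφ : IsModelConcurrent e φ U) (he : IsModelEnergy e U)
    (hz : z ∈ U) (v w : E × E) : omega (modelPhi e φ) z v w = 0 := by
  rw [omega, hφ.hess_modelPhi he hz, hφ.hess_modelPhi he hz, hφ.metric_hor z hz, sub_self]

/-- The derivative of `Φ` along the spray. -/
theorem fderiv_modelPhi_spray [FiniteDimensional ℝ E] (hφ : IsModelConcurrent e φ U)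
    (he : IsModelEnergy e U) (hz : z ∈ U) :
    fderiv ℝ (modelPhi e φ) z (modelSpray e z) = -(2 * e z) := by
  -- `g(η, η) = 2E` is horizontally constant, so this term of the Cartan identity disappears.
  have h1 : fderiv ℝ (fun z => modelMetric e z z.2 z.2) z
      (modelHor (modelSpray e) z (φ z)) = 0 := by
    have h2 : (fun z => modelMetric e z z.2 z.2) =ᶠ[nhds z] fun z => 2 * e z :=
      (he.eventually_mem hz).mono fun z hz =>
        (he.metric_eta_left hz z.2).trans (he.homogeneous z hz)
    rw [h2.fderiv_eq, fderiv_const_mul ((he.smooth z hz).differentiableAt (by simp)),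
      smul_apply, he.fderiv_hor hz, smul_zero]
  have h2 := hφ.metric_eta z hz
  rw [h1, he.metric_eta_left hz, he.metric_eta_left hz, he.homogeneous z hz] at h2
  -- The spray and the horizontal lift of `y` differ by a vertical vector, along which `φ` is
  -- constant.
  have h3 : fderiv ℝ φ z (modelSpray e z) = fderiv ℝ φ z (modelHor (modelSpray e) z z.2) := by
    rw [← sub_eq_zero, ← map_sub]
    have h4 : modelSpray e z - modelHor (modelSpray e) z z.2 =
        (0, (modelSpray e z - modelHor (modelSpray e) z z.2).2) :=
      Prod.ext (by simp [modelHor, he.spray_fst hz]) rfl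
    rw [h4, hφ.fderiv_vert z hz]
  -- Horizontal constancy of the energy along `β φ` trades `dE(φ, 0)` for the vertical part of `β φ`
  -- that occurs in the Cartan identity.
  have h5 := he.fderiv_hor hz (φ z)
  have h6 : modelHor (modelSpray e) z (φ z) =
      (φ z, 0) + (0, (modelHor (modelSpray e) z (φ z)).2) := by
    refine Prod.ext ?_ ?_ <;> simp [modelHor]
  have h7 : ∀ a b : E, ((0, a - b) : E × E) = (0, a) - (0, b) := by simp
  rw [h6, map_add] at h5
  rw [h7, map_sub] at h2
  rw [hφ.fderiv_modelPhi he hz, he.hess_spray hz, h3]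
  linarith

end IsModelConcurrent

end Model

/-! ### The changed energy and its spray on `E × E`. -/

section ModelMatsumoto

variable {E : Type*} [NormedAddCommGroup E] [NormedSpace ℝ E]

/-- The energy of the metric `F² / (F - Φ)`, as a function of `F` and `Φ`. -/
def matsumotoEnergy {V : Type*} (F Φ : V → ℝ) (z : V) : ℝ :=
  (1 / 2) * (F z ^ 2 / (F z - Φ z)) ^ 2

section Derivatives

variable {V : Type*} [NormedAddCommGroup V] [NormedSpace ℝ V] {F Φ : V → ℝ} {F' Φ' : V →L[ℝ] ℝ}
  {z : V}

/-- Covers both the energy and the two coefficients of its differential. The exponents are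
successors so that no truncated subtraction occurs. -/
theorem hasFDerivAt_pow_div_sub_pow (m n : ℕ) (hF : HasFDerivAt F F' z) (hΦ : HasFDerivAt Φ Φ' z)
    (hr : F z - Φ z ≠ 0) :
    HasFDerivAt (fun z => F z ^ (m + 1) / (F z - Φ z) ^ (n + 1))
      (((m + 1) * F z ^ m / (F z - Φ z) ^ (n + 1)
          - (n + 1) * F z ^ (m + 1) / (F z - Φ z) ^ (n + 2)) • F' +
        ((n + 1) * F z ^ (m + 1) / (F z - Φ z) ^ (n + 2)) • Φ') z := by
  have h1 : HasFDerivAt (fun z => F z ^ (m + 1)) (((m + 1) * F z ^ m) • F') z := by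
    exact ((hasDerivAt_pow (m + 1) (F z)).comp_hasFDerivAt z hF).congr_fderiv (by simp)
  have h2 : HasFDerivAt (fun z => ((F z - Φ z) ^ (n + 1))⁻¹)
      ((-(n + 1) / (F z - Φ z) ^ (n + 2)) • (F' - Φ')) z := by
    have h3 := ((hasDerivAt_pow (n + 1) (F z - Φ z)).fun_inv (pow_ne_zero _ hr)).comp_hasFDerivAt z
      (hF.sub hΦ)
    refine h3.congr_fderiv ?_
    congr 1
    field_simp
    push_cast
    simp
    ring
  have h4 := h1.mul h2
  simp only [div_eq_mul_inv]
  refine h4.congr_fderiv ?_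
  ext v
  simp
  field_simp
  ring

theorem hasFDerivAt_matsumotoEnergy (hF : HasFDerivAt F F' z) (hΦ : HasFDerivAt Φ Φ' z)
    (hr : F z - Φ z ≠ 0) :
    HasFDerivAt (matsumotoEnergy F Φ)
      ((2 * (F z ^ 3 / (F z - Φ z) ^ 2) - F z ^ 4 / (F z - Φ z) ^ 3) • F' +
        (F z ^ 4 / (F z - Φ z) ^ 3) • Φ') z := by
  have h := (hasFDerivAt_pow_div_sub_pow 3 1 hF hΦ hr).const_mul (1 / 2)
  have h2 : matsumotoEnergy F Φ = fun z => 1 / 2 * (F z ^ (3 + 1) / (F z - Φ z) ^ (1 + 1)) := by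
    funext z
    rw [matsumotoEnergy, div_pow, ← pow_mul]
  rw [h2]
  refine h.congr_fderiv ?_
  ext v
  simp
  field_simp
  ring

theorem hess_matsumotoEnergy (hF : ContDiffAt ℝ ∞ F z) (hΦ : ContDiffAt ℝ ∞ Φ z)
    (hr : F z - Φ z ≠ 0) (v w : V) :
    hess (matsumotoEnergy F Φ) z v w =
      (2 * (F z ^ 3 / (F z - Φ z) ^ 2) - F z ^ 4 / (F z - Φ z) ^ 3) * hess F z v w +
      F z ^ 4 / (F z - Φ z) ^ 3 * hess Φ z v w +
      (6 * F z ^ 2 / (F z - Φ z) ^ 2 - 8 * F z ^ 3 / (F z - Φ z) ^ 3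
        + 3 * F z ^ 4 / (F z - Φ z) ^ 4) * fderiv ℝ F z v * fderiv ℝ F z w +
      (4 * F z ^ 3 / (F z - Φ z) ^ 3 - 3 * F z ^ 4 / (F z - Φ z) ^ 4) *
        (fderiv ℝ F z v * fderiv ℝ Φ z w + fderiv ℝ Φ z v * fderiv ℝ F z w) +
      3 * F z ^ 4 / (F z - Φ z) ^ 4 * fderiv ℝ Φ z v * fderiv ℝ Φ z w := by
  have hd : ∀ {f : V → ℝ}, ContDiffAt ℝ ∞ f z → ∀ᶠ z in nhds z, DifferentiableAt ℝ f z :=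
    fun h => ((h.of_le (m := 1) (by norm_cast)).eventually (by simp)).mono fun z h =>
      h.differentiableAt (by simp)
  have hr' : ∀ᶠ z in nhds z, F z - Φ z ≠ 0 :=
    (hF.continuousAt.sub hΦ.continuousAt).eventually_ne hr
  have h1 : fderiv ℝ (matsumotoEnergy F Φ) =ᶠ[nhds z] fun z =>
      (2 * (F z ^ 3 / (F z - Φ z) ^ 2) - F z ^ 4 / (F z - Φ z) ^ 3) • fderiv ℝ F z +
        (F z ^ 4 / (F z - Φ z) ^ 3) • fderiv ℝ Φ z := by
    filter_upwards [hd hF, hd hΦ, hr'] with z h1 h2 h3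
    exact (hasFDerivAt_matsumotoEnergy h1.hasFDerivAt h2.hasFDerivAt h3).fderiv
  have hF1 := (hd hF).self_of_nhds.hasFDerivAt
  have hΦ1 := (hd hΦ).self_of_nhds.hasFDerivAt
  have h2 := hasFDerivAt_pow_div_sub_pow 2 1 hF1 hΦ1 hr
  have h3 := hasFDerivAt_pow_div_sub_pow 3 2 hF1 hΦ1 hr
  have hF2 := ((contDiffAt_fderiv hF).differentiableAt (by simp)).hasFDerivAt
  have hΦ2 := ((contDiffAt_fderiv hΦ).differentiableAt (by simp)).hasFDerivAt
  have h4 := (((h2.const_mul 2).sub h3).smul hF2).add (h3.smul hΦ2)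
  rw [hess, (h4.congr_of_eventuallyEq h1).fderiv]
  simp [hess]
  field_simp
  ring

end Derivatives

/-- The coefficient `f₁` as a function of `F`, `Φ` and `p²`. -/
def matsumotoCoeff₁ (F Φ P : ℝ) : ℝ := F * (4 * Φ - F) / (F * (1 + 2 * P) - 3 * Φ)

/-- The coefficient `f₂` as a function of `F`, `Φ` and `p²`. -/
def matsumotoCoeff₂ (F Φ P : ℝ) : ℝ := 2 * F ^ 3 / (F * (1 + 2 * P) - 3 * Φ)

variable [FiniteDimensional ℝ E] {F : E × E → ℝ} {U : Set (E × E)} {φ : E × E → E} {z : E × E}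

/-- The spray of the metric `F² / (F - Φ)` is `G - f₁ C + f₂ γφ`. -/
theorem omega_matsumotoEnergy (he : IsModelEnergy (fun z => 1 / 2 * F z ^ 2) U)
    (hφ : IsModelConcurrent (fun z => 1 / 2 * F z ^ 2) φ U) (hz : z ∈ U)
    (hF : ContDiffAt ℝ ∞ F z) (hF0 : F z ≠ 0)
    {Φ : E × E → ℝ} (hΦ : Φ = modelPhi (fun z => 1 / 2 * F z ^ 2) φ)
    (hr : F z - Φ z ≠ 0) {P : ℝ} (hP : P = modelMetric (fun z => 1 / 2 * F z ^ 2) z (φ z) (φ z))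
    (hΔ : F z * (1 + 2 * P) - 3 * Φ z ≠ 0) (w : E × E) :
    omega (matsumotoEnergy F Φ) z
      (modelSpray (fun z => 1 / 2 * F z ^ 2) z
        - matsumotoCoeff₁ (F z) (Φ z) P • (0, z.2) + matsumotoCoeff₂ (F z) (Φ z) P • (0, φ z)) w =
      -fderiv ℝ (matsumotoEnergy F Φ) z w := by
  set e : E × E → ℝ := fun z => 1 / 2 * F z ^ 2 with he_def
  have hΦs : ContDiffAt ℝ ∞ Φ z := hΦ ▸ hφ.contDiffAt_modelPhi he hz
  have hd : ∀ {f : E × E → ℝ}, ContDiffAt ℝ ∞ f z → ∀ᶠ z in nhds z, DifferentiableAt ℝ f z :=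
    fun h => ((h.of_le (m := 1) (by norm_cast)).eventually (by simp)).mono fun z h =>
      h.differentiableAt (by simp)
  have hF1 := (hd hF).self_of_nhds.hasFDerivAt
  have hΦ1 := (hd hΦs).self_of_nhds.hasFDerivAt
  have he1 : fderiv ℝ e =ᶠ[nhds z] fun z => F z • fderiv ℝ F z := by
    filter_upwards [hd hF] with z h
    have h1 := ((hasDerivAt_pow 2 (F z)).comp_hasFDerivAt z h.hasFDerivAt).const_mul (1 / 2)
    refine (h1.congr_fderiv (ContinuousLinearMap.ext fun v => ?_)).fderiv
    simp
    ring
  have he2 : ∀ v w, hess e z v w = F z * hess F z v w + fderiv ℝ F z v * fderiv ℝ F z w := by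
    intro v w
    have h1 := hF1.smul ((contDiffAt_fderiv hF).differentiableAt (by simp)).hasFDerivAt
    rw [hess, (h1.congr_of_eventuallyEq he1).fderiv]
    simp [hess]
  have he3 : ∀ v, fderiv ℝ e z v = F z * fderiv ℝ F z v := fun v => by
    rw [he1.self_of_nhds]; rfl
  obtain ⟨S, hS⟩ : ∃ S, S = modelSpray e z := ⟨_, rfl⟩
  have hS1 : S.1 = z.2 := hS ▸ he.spray_fst hz
  have hSo : omega e z S w = -(F z * fderiv ℝ F z w) := by
    rw [hS, he.omega_spray hz, he3]
  have hSF : fderiv ℝ F z S = 0 := by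
    have := he.fderiv_spray hz
    rw [← hS, he3] at this
    exact (mul_eq_zero.1 this).resolve_left hF0
  have hSΦ : fderiv ℝ Φ z S = -F z ^ 2 := by
    rw [hS, hΦ, hφ.fderiv_modelPhi_spray he hz]
    ring
  have hFy : fderiv ℝ F z (0, z.2) = F z := by
    have h := he.homogeneous z hz
    rw [he3] at h
    exact mul_left_cancel₀ hF0 (h.trans (by rw [he_def]; ring))
  have hΦy : fderiv ℝ Φ z (0, z.2) = Φ z := by
    rw [hΦ, hφ.fderiv_modelPhi_vert he hz, modelPhi]
  have hFφ : fderiv ℝ F z (0, φ z) = Φ z / F z := by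
    rw [eq_div_iff hF0, mul_comm, ← he3, hΦ, modelPhi, he.metric_eta_right hz]
  have hΦφ : fderiv ℝ Φ z (0, φ z) = P := by
    rw [hP, hΦ, hφ.fderiv_modelPhi_vert he hz]
  have hov : ∀ b, omega e z (0, b) w = modelMetric e z b w.1 := fun b => by
    rw [omega, modelMetric, Prod.mk_zero_zero, map_zero, sub_zero]
  have hoy : omega e z (0, z.2) w = F z * fderiv ℝ F z (0, w.1) := by
    rw [hov, he.metric_eta_left hz, he3]
  have hoφ : omega e z (0, φ z) w = fderiv ℝ Φ z (0, w.1) := by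
    rw [hov, hΦ, hφ.fderiv_modelPhi_vert he hz]
  obtain ⟨c₁, hc₁⟩ : ∃ c, c = matsumotoCoeff₁ (F z) (Φ z) P := ⟨_, rfl⟩
  obtain ⟨c₂, hc₂⟩ : ∃ c, c = matsumotoCoeff₂ (F z) (Φ z) P := ⟨_, rfl⟩
  obtain ⟨T, hT⟩ : ∃ T, T = S - c₁ • ((0, z.2) : E × E) + c₂ • (0, φ z) := ⟨_, rfl⟩
  rw [← hS, ← hc₁, ← hc₂, ← hT]
  have hT1 : T.1 = z.2 := by simp [hT, hS1]
  have hTF : fderiv ℝ F z T = -(c₁ * F z) + c₂ * (Φ z / F z) := by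
    simp only [hT, map_add, map_sub, map_smul, hSF, hFy, hFφ, smul_eq_mul]
    ring
  have hTΦ : fderiv ℝ Φ z T = -F z ^ 2 - c₁ * Φ z + c₂ * P := by
    simp only [hT, map_add, map_sub, map_smul, hSΦ, hΦy, hΦφ, smul_eq_mul]
  have hTo : omega e z T w = -(F z * fderiv ℝ F z w) - c₁ * (F z * fderiv ℝ F z (0, w.1))
      + c₂ * fderiv ℝ Φ z (0, w.1) := by
    have hlin : omega e z T w = omega e z S w - c₁ * omega e z (0, z.2) w
        + c₂ * omega e z (0, φ z) w := by
      have hs := he.smooth z hz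
      simp only [← omegaCLM_apply hs, hT, map_add, map_sub, map_smul, add_apply, sub_apply,
        smul_apply, smul_eq_mul]
    rw [hlin, hSo, hoy, hoφ]
  -- This is `dd_J Φ = 0`, with `T₁ = y`.
  have hΦo : hess Φ z T (0, w.1) = hess Φ z w (0, z.2) := by
    have := hφ.omega_modelPhi he hz T w
    rw [← hΦ, omega, hT1] at this
    linarith
  -- `F dd_J F = dd_J E - dF ∧ d_J F`, contracted with `T`. This removes the Hessian of `F` in the
  -- direction `T`.
  have hFo : hess F z T (0, w.1) = hess F z w (0, z.2) + (-(F z * fderiv ℝ F z w)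
      - c₁ * (F z * fderiv ℝ F z (0, w.1)) + c₂ * fderiv ℝ Φ z (0, w.1)
      - fderiv ℝ F z T * fderiv ℝ F z (0, w.1) + fderiv ℝ F z w * F z) / F z := by
    rw [omega, he2, he2, hT1, hFy] at hTo
    field_simp
    linarith
  rw [omega, hess_matsumotoEnergy hF hΦs hr, hess_matsumotoEnergy hF hΦs hr,
    (hasFDerivAt_matsumotoEnergy hF1 hΦ1 hr).fderiv, hT1, hΦo, hFo, hFy, hΦy, hTF, hTΦ]
  simp only [add_apply, smul_apply, smul_eq_mul]
  generalize fderiv ℝ F z w = A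
  generalize fderiv ℝ Φ z w = B
  generalize fderiv ℝ F z (0, w.1) = a
  generalize fderiv ℝ Φ z (0, w.1) = b
  generalize hess F z w (0, z.2) = h1
  generalize hess Φ z w (0, z.2) = h2
  rw [hc₁, hc₂, matsumotoCoeff₁, matsumotoCoeff₂]
  generalize F z = f at hF0 hr hΔ ⊢
  generalize Φ z = g at hr hΔ ⊢
  -- Solving for `P` in terms of the denominator `d` makes `d` an atom, so that clearing fractions
  -- leaves a polynomial identity.
  obtain ⟨d, hd⟩ : ∃ d, d = f * (1 + 2 * P) - 3 * g := ⟨_, rfl⟩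
  have hP' : P = ((d + 3 * g) / f - 1) / 2 := by
    field_simp
    linarith
  rw [← hd] at hΔ ⊢
  rw [hP']
  field_simp
  ring

end ModelMatsumoto

/-! ### From the intrinsic conditions on `F` and `φ` to the conditions in coordinates. -/

section Translation

variable {E : Type*} [NormedAddCommGroup E] [NormedSpace ℝ E]
  {M : Type*} [TopologicalSpace M] [ChartedSpace E M] [IsManifold 𝓘(ℝ, E) ∞ M]
  {o p : TangentBundle 𝓘(ℝ, E) M} {F : TangentBundle 𝓘(ℝ, E) M → ℝ} {φ : PiField E M}

/-- The energy of `F` in the coordinates around `o`. -/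
def chartEnergy (o : TangentBundle 𝓘(ℝ, E) M) (F : TangentBundle 𝓘(ℝ, E) M → ℝ) : E × E → ℝ :=
  fun z => 1 / 2 * F (crdSymm o z) ^ 2

theorem chartEnergy_hasRep (hp : p ∈ chartDom o) : HasRep o (energy F) (chartEnergy o F) p :=
  hasRep_comp_crdSymm (energy F) hp

theorem exists_of_mem_slitTarget {z : E × E} (hz : z ∈ slitTarget o) :
    ∃ p ∈ chartDom o, p ∈ slit E M ∧ crd o p = z := by
  have h := crd_crdSymm hz.1
  refine ⟨crdSymm o z, crdSymm_mem hz.1, ?_, h⟩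
  rw [← crd_mem_slitTarget (crdSymm_mem hz.1), h]
  exact hz

namespace IsFinsler

theorem contMDiffAt (hF : IsFinsler F) (hp : p ∈ slit E M) :
    ContMDiffAt 𝓘(ℝ, E).tangent 𝓘(ℝ, ℝ) ∞ F p :=
  hF.smooth.contMDiffAt (isOpen_slit.mem_nhds hp)

theorem contDiffAt (hF : IsFinsler F) (hp : p ∈ chartDom o) (hs : p ∈ slit E M) :
    ContDiffAt ℝ ∞ (fun z => F (crdSymm o z)) (crd o p) :=
  contDiffAt_comp_crdSymm hp (hF.contMDiffAt hs)

theorem contDiffAt_energy (hF : IsFinsler F) (hp : p ∈ chartDom o) (hs : p ∈ slit E M) :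
    ContDiffAt ℝ ∞ (chartEnergy o F) (crd o p) :=
  contDiffAt_const.mul ((hF.contDiffAt hp hs).pow 2)

theorem fderiv_energy (hF : IsFinsler F) (hp : p ∈ chartDom o) (hs : p ∈ slit E M) :
    fderiv ℝ (chartEnergy o F) (crd o p) (0, (crd o p).2) = 2 * chartEnergy o F (crd o p) := by
  have hd := ((hF.contDiffAt_energy hp hs).differentiableAt (by simp)).hasFDerivAt
  have hline : HasDerivAt (fun t : ℝ => ((crd o p).1, t • (crd o p).2)) (0, (crd o p).2) 1 := by
    have h := (hasDerivAt_id (1 : ℝ)).smul_const (crd o p).2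
    rw [one_smul] at h
    exact (hasDerivAt_const _ _).prodMk h
  have h1 : HasDerivAt (fun t : ℝ => chartEnergy o F ((crd o p).1, t • (crd o p).2))
      (fderiv ℝ (chartEnergy o F) (crd o p) (0, (crd o p).2)) 1 := by
    refine HasFDerivAt.comp_hasDerivAt (x := (1 : ℝ)) (l := chartEnergy o F) ?_ hline
    simpa using hd
  have h2 : HasDerivAt (fun t : ℝ => t ^ 2 * chartEnergy o F (crd o p))
      (2 * chartEnergy o F (crd o p)) 1 := by
    simpa using (hasDerivAt_pow 2 (1 : ℝ)).mul_const (chartEnergy o F (crd o p))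
  refine h1.unique (h2.congr_of_eventuallyEq ?_)
  -- Homogeneity is available for positive scalars only, which is enough for the derivative at `t =
  -- 1`.
  filter_upwards [lt_mem_nhds (zero_lt_one (α := ℝ))] with t ht
  have h3 : ((crd o p).1, t • (crd o p).2) =
      crd o (⟨p.proj, t • p.snd⟩ : TangentBundle 𝓘(ℝ, E) M) := by
    have h4 := crd_mk hp (t • p.snd)
    rw [h4, crd_eq hp, map_smul]
  have hq : (⟨p.proj, t • p.snd⟩ : TangentBundle 𝓘(ℝ, E) M) ∈ chartDom o :=
    mem_chartDom.2 (mem_chartDom.1 hp)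
  rw [h3, chartEnergy, crdSymm_crd hq, hF.homogeneous p t ht, chartEnergy, crdSymm_crd hp]
  ring

theorem isModelEnergy [CompleteSpace E] (hF : IsFinsler F) (o : TangentBundle 𝓘(ℝ, E) M) :
    IsModelEnergy (chartEnergy o F) (slitTarget o) where
  isOpen := isOpen_slitTarget
  smooth := by
    intro z hz
    obtain ⟨p, hp, hs, rfl⟩ := exists_of_mem_slitTarget hz
    exact hF.contDiffAt_energy hp hs
  homogeneous := by
    intro z hz
    obtain ⟨p, hp, hs, rfl⟩ := exists_of_mem_slitTarget hz
    exact hF.fderiv_energy hp hs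
  nondegenerate := by
    intro z hz
    obtain ⟨p, hp, hs, rfl⟩ := exists_of_mem_slitTarget hz
    exact (hF.maxRank p hs).omega_eq_zero hp (chartEnergy_hasRep hp) (hF.contDiffAt_energy hp hs)

/-- A Finsler metric is positive on the slit tangent bundle. -/
theorem ne_zero [CompleteSpace E] (hF : IsFinsler F) (hs : p ∈ slit E M) : F p ≠ 0 := by
  intro h0
  have hp := mem_chartDom_self (o := p)
  have hz : crd p p ∈ slitTarget p := (crd_mem_slitTarget hp).2 hs
  have he := hF.isModelEnergy p
  have h1 : chartEnergy p F (crd p p) = 0 := by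
    rw [chartEnergy, crdSymm_crd hp, h0]
    ring
  -- A zero of `F` minimises the energy, so `dE = 0` there. Euler's relation then puts the nonzero
  -- vector `(0, y)` in the kernel of `dd_J E`.
  have h2 : fderiv ℝ (chartEnergy p F) (crd p p) = 0 := by
    refine IsLocalMin.fderiv_eq_zero (Filter.Eventually.of_forall fun z => ?_)
    rw [h1, chartEnergy]
    positivity
  have h3 := he.nondegenerate _ hz (0, (crd p p).2) fun w => by
    rw [omega, hess_symm (he.smooth _ hz), he.hess_eta hz, h2, Prod.mk_zero_zero, map_zero]
    simp
  exact hz.2 (congrArg Prod.snd h3)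

theorem spray_hasComps [FiniteDimensional ℝ E] (hF : IsFinsler F) (hp : p ∈ chartDom o)
    (hs : p ∈ slit E M) : HasComps o (spray F) (modelSpray (chartEnergy o F)) p := by
  filter_upwards [chartDom_mem_nhds hp, isOpen_slit.mem_nhds hs] with q hq hqs
  have hz : crd o q ∈ slitTarget o := (crd_mem_slitTarget hq).2 hqs
  obtain ⟨ξ, hξ⟩ := dcrd_surjective hq (modelSpray (chartEnergy o F) (crd o q))
  rw [(hF.maxRank q hqs).spray_eq hq (chartEnergy_hasRep hq) (hF.contDiffAt_energy hq hqs)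
    (ξ := ξ) fun w => by rw [hξ, (hF.isModelEnergy o).omega_spray hz], hξ]

variable [FiniteDimensional ℝ E]

theorem eventually_spray_fst (hF : IsFinsler F) (hp : p ∈ chartDom o) (hs : p ∈ slit E M) :
    ∀ᶠ z in nhds (crd o p), (modelSpray (chartEnergy o F) z).1 = z.2 :=
  ((hF.isModelEnergy o).eventually_mem ((crd_mem_slitTarget hp).2 hs)).mono fun _ hz =>
    (hF.isModelEnergy o).spray_fst hz

theorem contDiffAt_spray (hF : IsFinsler F) (hp : p ∈ chartDom o) (hs : p ∈ slit E M) :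
    ContDiffAt ℝ ∞ (modelSpray (chartEnergy o F)) (crd o p) :=
  (hF.isModelEnergy o).contDiffAt_spray ((crd_mem_slitTarget hp).2 hs)

theorem dcrd_bet (hF : IsFinsler F) (hp : p ∈ chartDom o) (hs : p ∈ slit E M)
    (w : TangentSpace 𝓘(ℝ, E) p.proj) :
    dcrd o p (bet F p w) = modelHor (modelSpray (chartEnergy o F)) (crd o p) (bcrd o p w) :=
  FinslerGeom.dcrd_bet hp (hF.spray_hasComps hp hs) ((hF.contDiffAt_spray hp hs).of_le
    (by norm_cast)) (hF.eventually_spray_fst hp hs) w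

theorem hor_hasComps (hF : IsFinsler F) (hp : p ∈ chartDom o) (hs : p ∈ slit E M)
    {X : PiField E M} {X' : E × E → E} (hX : HasPiComps o X X' p) :
    HasComps o (hor F X) (fun z => modelHor (modelSpray (chartEnergy o F)) z (X' z)) p := by
  filter_upwards [chartDom_mem_nhds hp, isOpen_slit.mem_nhds hs, hX] with q hq hqs hqX
  rw [hor, hF.dcrd_bet hq hqs, hqX]

theorem contDiffAt_hor (hF : IsFinsler F) (hp : p ∈ chartDom o) (hs : p ∈ slit E M)
    {X' : E × E → E} (hX : ContDiffAt ℝ ∞ X' (crd o p)) :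
    ContDiffAt ℝ ∞ (fun z => modelHor (modelSpray (chartEnergy o F)) z (X' z)) (crd o p) := by
  have h := ((hF.contDiffAt_spray hp hs).fderiv_right (m := ∞) (by simp)).clm_apply
    ((contDiffAt_const (c := (0 : E))).prodMk hX)
  exact hX.prodMk (contDiffAt_const.smul h.snd)

variable {X Y Z : PiField E M} {X' Y' Z' : E × E → E}

theorem bcrd_rho_bracket {V W : TMField E M} {V' W' : E × E → E × E} (hp : p ∈ chartDom o)
    (hV : HasComps o V V' p) (hW : HasComps o W W' p)
    (hV' : ContDiffAt ℝ ∞ V' (crd o p)) (hW' : ContDiffAt ℝ ∞ W' (crd o p)) :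
    bcrd o p (rho p (bracket V W p)) =
      fderiv ℝ (fun z => (W' z).1) (crd o p) (V' (crd o p)) -
        fderiv ℝ (fun z => (V' z).1) (crd o p) (W' (crd o p)) := by
  rw [← dcrd_fst hp, dcrd_bracket hp hV hW (hV'.of_le (by norm_cast)) (hW'.of_le (by norm_cast)),
    (hV'.differentiableAt (by simp)).hasFDerivAt.fst.fderiv,
    (hW'.differentiableAt (by simp)).hasFDerivAt.fst.fderiv]
  rfl

theorem bcrd_rho_bracket_hor (hF : IsFinsler F) (hp : p ∈ chartDom o) (hs : p ∈ slit E M)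
    (hX : HasPiComps o X X' p) (hY : HasPiComps o Y Y' p)
    (hX' : ContDiffAt ℝ ∞ X' (crd o p)) (hY' : ContDiffAt ℝ ∞ Y' (crd o p)) :
    bcrd o p (rho p (bracket (hor F X) (hor F Y) p)) =
      fderiv ℝ Y' (crd o p)
          (modelHor (modelSpray (chartEnergy o F)) (crd o p) (X' (crd o p))) -
        fderiv ℝ X' (crd o p)
          (modelHor (modelSpray (chartEnergy o F)) (crd o p) (Y' (crd o p))) :=
  bcrd_rho_bracket hp (hF.hor_hasComps hp hs hX) (hF.hor_hasComps hp hs hY)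
    (hF.contDiffAt_hor hp hs hX') (hF.contDiffAt_hor hp hs hY')

/-- The `x`-component of `β Y` is `Y` and that of `γ X` is zero, so only the vertical derivative of
`Y` survives. For `Y = φ`, the vertical Berwald condition therefore says that `φ` does not depend on
`y`. -/
theorem bcrd_rho_bracket_vert_hor (hF : IsFinsler F) (hp : p ∈ chartDom o) (hs : p ∈ slit E M)
    (hX : HasPiComps o X X' p) (hY : HasPiComps o Y Y' p)
    (hX' : ContDiffAt ℝ ∞ X' (crd o p)) (hY' : ContDiffAt ℝ ∞ Y' (crd o p)) :
    bcrd o p (rho p (bracket (vert X) (hor F Y) p)) =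
      fderiv ℝ Y' (crd o p) (0, X' (crd o p)) := by
  rw [bcrd_rho_bracket hp (vert_hasComps hp hX) (hF.hor_hasComps hp hs hY)
    (contDiffAt_const.prodMk hX') (hF.contDiffAt_hor hp hs hY')]
  simp [modelHor]

theorem bcrd_rho_bracket_hor_vert (hF : IsFinsler F) (hp : p ∈ chartDom o) (hs : p ∈ slit E M)
    (hX : HasPiComps o X X' p) (hY : HasPiComps o Y Y' p)
    (hX' : ContDiffAt ℝ ∞ X' (crd o p)) (hY' : ContDiffAt ℝ ∞ Y' (crd o p)) :
    bcrd o p (rho p (bracket (hor F Y) (vert X) p)) =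
      -fderiv ℝ Y' (crd o p) (0, X' (crd o p)) := by
  rw [bcrd_rho_bracket hp (hF.hor_hasComps hp hs hY) (vert_hasComps hp hX)
    (hF.contDiffAt_hor hp hs hY') (contDiffAt_const.prodMk hX')]
  simp [modelHor]

theorem metric_eq (hF : IsFinsler F) (hp : p ∈ chartDom o) (hs : p ∈ slit E M)
    (w z : TangentSpace 𝓘(ℝ, E) p.proj) :
    metric F p w z = modelMetric (chartEnergy o F) (crd o p) (bcrd o p w) (bcrd o p z) :=
  FinslerGeom.metric_eq hp (chartEnergy_hasRep hp) (hF.contDiffAt_energy hp hs) w z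

theorem dFun_metricFun (hF : IsFinsler F) (hp : p ∈ chartDom o) (hs : p ∈ slit E M)
    (hX : HasPiComps o X X' p) (hY : HasPiComps o Y Y' p)
    (hX' : ContDiffAt ℝ ∞ X' (crd o p)) (hY' : ContDiffAt ℝ ∞ Y' (crd o p))
    (v : TangentSpace 𝓘(ℝ, E).tangent p) :
    dFun (metricFun F X Y) p v =
      fderiv ℝ (fun z => modelMetric (chartEnergy o F) z (X' z) (Y' z)) (crd o p)
        (dcrd o p v) := by
  have he := hF.isModelEnergy o
  have hz := (crd_mem_slitTarget hp).2 hs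
  refine (metricFun_hasRep hp (chartEnergy_hasRep hp)
    ((he.eventually_mem hz).mono he.smooth) hX hY).dFun_eq hp ?_ v
  exact (((contDiffAt_hess (he.smooth _ hz)).clm_apply (contDiffAt_const.prodMk hX')).clm_apply
    (contDiffAt_const.prodMk hY')).differentiableAt (by simp)

/-- The vertical Cartan derivative in coordinates. -/
theorem isCartanVert_eq (hF : IsFinsler F) (hp : p ∈ chartDom o) (hs : p ∈ slit E M)
    {c : TangentSpace 𝓘(ℝ, E) p.proj} (h : IsCartanVert F X Y p c) (hZs : PiSmoothAt Z p)
    (hX : HasPiComps o X X' p) (hY : HasPiComps o Y Y' p) (hZ : HasPiComps o Z Z' p)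
    (hX' : ContDiffAt ℝ ∞ X' (crd o p)) (hY' : ContDiffAt ℝ ∞ Y' (crd o p))
    (hZ' : ContDiffAt ℝ ∞ Z' (crd o p)) :
    2 * modelMetric (chartEnergy o F) (crd o p) (bcrd o p c) (Z' (crd o p)) =
      fderiv ℝ (fun z => modelMetric (chartEnergy o F) z (Y' z) (Z' z)) (crd o p)
        (0, X' (crd o p))
      + modelMetric (chartEnergy o F) (crd o p) (Y' (crd o p))
          (-fderiv ℝ Z' (crd o p) (0, X' (crd o p)))
      + modelMetric (chartEnergy o F) (crd o p) (Z' (crd o p))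
          (fderiv ℝ Y' (crd o p) (0, X' (crd o p))) := by
  have h1 := h Z hZs
  rw [hF.metric_eq hp hs, hF.metric_eq hp hs, hF.metric_eq hp hs,
    hF.dFun_metricFun hp hs hY hZ hY' hZ', (vert_hasComps hp hX).self_of_nhds,
    hF.bcrd_rho_bracket_vert_hor hp hs hX hY hX' hY',
    hF.bcrd_rho_bracket_hor_vert hp hs hX hZ hX' hZ', hY.self_of_nhds, hZ.self_of_nhds] at h1
  exact h1

/-- The horizontal Cartan derivative in coordinates. -/
theorem isCartanHor_eq (hF : IsFinsler F) (hp : p ∈ chartDom o) (hs : p ∈ slit E M)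
    {c : TangentSpace 𝓘(ℝ, E) p.proj} (h : IsCartanHor F X Y p c) (hZs : PiSmoothAt Z p)
    (hX : HasPiComps o X X' p) (hY : HasPiComps o Y Y' p) (hZ : HasPiComps o Z Z' p)
    (hX' : ContDiffAt ℝ ∞ X' (crd o p)) (hY' : ContDiffAt ℝ ∞ Y' (crd o p))
    (hZ' : ContDiffAt ℝ ∞ Z' (crd o p)) {g : E × E → E → E → ℝ} {z : E × E} {b : E → E × E}
    (hg : g = modelMetric (chartEnergy o F)) (hz : z = crd o p)
    (hb : b = modelHor (modelSpray (chartEnergy o F)) z) :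
    2 * g z (bcrd o p c) (Z' z) =
      fderiv ℝ (fun z => g z (Y' z) (Z' z)) z (b (X' z))
      + fderiv ℝ (fun z => g z (Z' z) (X' z)) z (b (Y' z))
      - fderiv ℝ (fun z => g z (X' z) (Y' z)) z (b (Z' z))
      - g z (X' z) (fderiv ℝ Z' z (b (Y' z)) - fderiv ℝ Y' z (b (Z' z)))
      + g z (Y' z) (fderiv ℝ X' z (b (Z' z)) - fderiv ℝ Z' z (b (X' z)))
      + g z (Z' z) (fderiv ℝ Y' z (b (X' z)) - fderiv ℝ X' z (b (Y' z))) := by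
  subst hg hz hb
  have h1 := h Z hZs
  rw [hF.metric_eq hp hs, hF.metric_eq hp hs, hF.metric_eq hp hs, hF.metric_eq hp hs,
    hF.dFun_metricFun hp hs hY hZ hY' hZ', hF.dFun_metricFun hp hs hZ hX hZ' hX',
    hF.dFun_metricFun hp hs hX hY hX' hY', (hF.hor_hasComps hp hs hX).self_of_nhds,
    (hF.hor_hasComps hp hs hY).self_of_nhds, (hF.hor_hasComps hp hs hZ).self_of_nhds,
    hF.bcrd_rho_bracket_hor hp hs hX hY hX' hY', hF.bcrd_rho_bracket_hor hp hs hY hZ hY' hZ',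
    hF.bcrd_rho_bracket_hor hp hs hZ hX hZ' hX', hX.self_of_nhds, hY.self_of_nhds,
    hZ.self_of_nhds] at h1
  exact h1

end IsFinsler

theorem IsConcurrent.isModelConcurrent [FiniteDimensional ℝ E] (hF : IsFinsler F)
    (hφ : IsConcurrent F φ) (o : TangentBundle 𝓘(ℝ, E) M) :
    IsModelConcurrent (chartEnergy o F) (piComps o φ) (slitTarget o) := by
  have he := hF.isModelEnergy o
  have hsm : ∀ z ∈ slitTarget o, ContDiffAt ℝ ∞ (piComps o φ) z := by
    intro z hz
    obtain ⟨p, hp, hs, rfl⟩ := exists_of_mem_slitTarget hz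
    exact contDiffAt_piComps hp (hφ.smooth p hs)
  have hvert : ∀ z ∈ slitTarget o, ∀ w, fderiv ℝ (piComps o φ) z (0, w) = 0 := by
    intro z hz w
    obtain ⟨p, hp, hs, rfl⟩ := exists_of_mem_slitTarget hz
    obtain ⟨W, hWs, hW⟩ := exists_constant_piField hp w
    have h1 := congrArg (bcrd o p) (hφ.berwald_vert p hs W hWs)
    rw [berwaldVert, hF.bcrd_rho_bracket_vert_hor hp hs hW (hasPiComps_piComps φ hp)
      contDiffAt_const (hsm _ hz)] at h1
    exact h1.trans (map_zero _)
  have hsymm : ∀ z ∈ slitTarget o, ∀ a b, modelMetric (chartEnergy o F) z a b =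
      modelMetric (chartEnergy o F) z b a := fun z hz a b => hess_symm (he.smooth z hz) _ _
  have hg0 : ∀ (z : E × E) (a : E), modelMetric (chartEnergy o F) z a 0 = 0 := fun z a => by
    rw [modelMetric, Prod.mk_zero_zero, map_zero]
  have hgneg : ∀ (z : E × E) (a b : E), modelMetric (chartEnergy o F) z a (-b) =
      -modelMetric (chartEnergy o F) z a b := fun z a b => by
    have : ((0, -b) : E × E) = -(0, b) := by simp
    rw [modelMetric, this, map_neg, modelMetric]
  have hfsymm : ∀ z ∈ slitTarget o, ∀ X Y : E × E → E,
      fderiv ℝ (fun z => modelMetric (chartEnergy o F) z (X z) (Y z)) z =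
      fderiv ℝ (fun z => modelMetric (chartEnergy o F) z (Y z) (X z)) z := fun z hz X Y =>
    Filter.EventuallyEq.fderiv_eq ((he.eventually_mem hz).mono fun z hz => hsymm z hz _ _)
  refine ⟨hsm, hvert, ?_, ?_, ?_⟩
  · intro z hz a b
    obtain ⟨p, hp, hs, rfl⟩ := exists_of_mem_slitTarget hz
    obtain ⟨A, hAs, hA⟩ := exists_constant_piField hp a
    obtain ⟨B, hBs, hB⟩ := exists_constant_piField hp b
    have h1 := hF.isCartanVert_eq hp hs (hφ.cartan_vert p hs A hAs) hBs hA
      (hasPiComps_piComps φ hp) hB contDiffAt_const (hsm _ hz) contDiffAt_const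
    rw [map_zero, hsymm _ hz, hvert _ hz] at h1
    simp only [hg0, fderiv_fun_const, Pi.zero_apply, zero_apply, neg_zero, mul_zero,
      add_zero] at h1
    exact h1.symm
  · intro z hz a b
    obtain ⟨p, hp, hs, rfl⟩ := exists_of_mem_slitTarget hz
    obtain ⟨A, hAs, hA⟩ := exists_constant_piField hp a
    obtain ⟨B, hBs, hB⟩ := exists_constant_piField hp b
    have h1 := hF.isCartanHor_eq hp hs (hφ.cartan_hor p hs A hAs) hBs hA
      (hasPiComps_piComps φ hp) hB contDiffAt_const (hsm _ hz) contDiffAt_const rfl rfl rfl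
    -- The same identity with the constant fields `A` and `B` exchanged. In the difference, the
    -- symmetric terms and the derivatives of `φ` cancel, leaving the antisymmetric part of the
    -- horizontal derivative of `g(φ, ·)`.
    have h2 := hF.isCartanHor_eq hp hs (hφ.cartan_hor p hs B hBs) hAs hB
      (hasPiComps_piComps φ hp) hA contDiffAt_const (hsm _ hz) contDiffAt_const rfl rfl rfl
    rw [map_neg, hA.self_of_nhds, hsymm _ hz, hgneg, hfsymm _ hz (fun _ => a) (piComps o φ)] at h1
    rw [map_neg, hB.self_of_nhds, hsymm _ hz, hgneg, hfsymm _ hz (fun _ => b) (piComps o φ),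
      hfsymm _ hz (fun _ => a) (fun _ => b), hsymm _ hz a b] at h2
    simp only [fderiv_fun_const, Pi.zero_apply, zero_apply, sub_zero, zero_sub, sub_self, hg0,
      hgneg] at h1 h2
    linarith
  · intro z hz
    obtain ⟨p, hp, hs, rfl⟩ := exists_of_mem_slitTarget hz
    -- Here `η` is both the direction and the test field, so the two derivatives of `g(φ, η)` along
    -- `β η` cancel.
    have h1 := hF.isCartanHor_eq hp hs (hφ.cartan_hor p hs _ eta_piSmoothAt) eta_piSmoothAt
      (eta_hasPiComps hp) (hasPiComps_piComps φ hp) (eta_hasPiComps hp) contDiffAt_snd (hsm _ hz)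
      contDiffAt_snd rfl rfl rfl
    rw [map_neg, (eta_hasPiComps hp).self_of_nhds, hsymm _ hz, hgneg, sub_self, hg0,
      hfsymm _ hz (fun z => z.2) (piComps o φ), fderiv_snd] at h1
    simp only [ContinuousLinearMap.coe_snd'] at h1
    have h2 := hgneg (crd o p) (crd o p).2
      ((modelHor (modelSpray (chartEnergy o F)) (crd o p) (piComps o φ (crd o p))).2 -
        fderiv ℝ (piComps o φ) (crd o p)
          (modelHor (modelSpray (chartEnergy o F)) (crd o p) (crd o p).2))
    rw [neg_sub] at h2
    linarith

end Translation

/-! ### The spray of the changed metric on `TM`, and the two relations. -/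

section Main

variable {E : Type*} [NormedAddCommGroup E] [NormedSpace ℝ E] [FiniteDimensional ℝ E]
  {M : Type*} [TopologicalSpace M] [ChartedSpace E M] [IsManifold 𝓘(ℝ, E) ∞ M]
  {o p : TangentBundle 𝓘(ℝ, E) M} {F : TangentBundle 𝓘(ℝ, E) M → ℝ} {φ : PiField E M}

/-- The function `Φ` in the coordinates around `o`. -/
def chartPhi (o : TangentBundle 𝓘(ℝ, E) M) (F : TangentBundle 𝓘(ℝ, E) M → ℝ) (φ : PiField E M) :
    E × E → ℝ :=
  modelPhi (chartEnergy o F) (piComps o φ)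

/-- The function `p²` in the coordinates around `o`. -/
def chartPSq (o : TangentBundle 𝓘(ℝ, E) M) (F : TangentBundle 𝓘(ℝ, E) M → ℝ) (φ : PiField E M) :
    E × E → ℝ :=
  fun z => modelMetric (chartEnergy o F) z (piComps o φ z) (piComps o φ z)

/-- The function `f₁` in the coordinates around `o`. -/
def chartCoeff₁ (o : TangentBundle 𝓘(ℝ, E) M) (F : TangentBundle 𝓘(ℝ, E) M → ℝ)
    (φ : PiField E M) : E × E → ℝ :=
  fun z => matsumotoCoeff₁ (F (crdSymm o z)) (chartPhi o F φ z) (chartPSq o F φ z)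

/-- The function `f₂` in the coordinates around `o`. -/
def chartCoeff₂ (o : TangentBundle 𝓘(ℝ, E) M) (F : TangentBundle 𝓘(ℝ, E) M → ℝ)
    (φ : PiField E M) : E × E → ℝ :=
  fun z => matsumotoCoeff₂ (F (crdSymm o z)) (chartPhi o F φ z) (chartPSq o F φ z)

/-- The components of the spray of `F² / (F - Φ)`. -/
def chartMatsumotoSpray (o : TangentBundle 𝓘(ℝ, E) M) (F : TangentBundle 𝓘(ℝ, E) M → ℝ)
    (φ : PiField E M) : E × E → E × E :=
  fun z => modelSpray (chartEnergy o F) z - chartCoeff₁ o F φ z • (0, z.2)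
    + chartCoeff₂ o F φ z • (0, piComps o φ z)

theorem chartPhi_crd (hF : IsFinsler F) (hp : p ∈ chartDom o) (hs : p ∈ slit E M) :
    chartPhi o F φ (crd o p) = bigPhi F φ p := by
  rw [bigPhi, hF.metric_eq hp hs, (hasPiComps_piComps φ hp).self_of_nhds,
    (eta_hasPiComps hp).self_of_nhds]
  rfl

theorem chartPSq_crd (hF : IsFinsler F) (hp : p ∈ chartDom o) (hs : p ∈ slit E M) :
    chartPSq o F φ (crd o p) = pSq F φ p := by
  rw [pSq, hF.metric_eq hp hs, (hasPiComps_piComps φ hp).self_of_nhds]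
  rfl

theorem delta_eq (hF : IsFinsler F) (hp : p ∈ chartDom o) (hs : p ∈ slit E M) :
    F (crdSymm o (crd o p)) * (1 + 2 * chartPSq o F φ (crd o p)) - 3 * chartPhi o F φ (crd o p) =
      deltaFun F φ p := by
  rw [crdSymm_crd hp, chartPhi_crd hF hp hs, chartPSq_crd hF hp hs, deltaFun]

theorem f₁_hasRep (hF : IsFinsler F) (hp : p ∈ chartDom o) (hs : p ∈ slit E M) :
    HasRep o (f₁ F φ) (chartCoeff₁ o F φ) p := by
  filter_upwards [chartDom_mem_nhds hp, isOpen_slit.mem_nhds hs] with q hq hqs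
  rw [f₁, ← delta_eq hF hq hqs, chartCoeff₁, matsumotoCoeff₁, crdSymm_crd hq,
    chartPhi_crd hF hq hqs]

theorem f₂_hasRep (hF : IsFinsler F) (hp : p ∈ chartDom o) (hs : p ∈ slit E M) :
    HasRep o (f₂ F φ) (chartCoeff₂ o F φ) p := by
  filter_upwards [chartDom_mem_nhds hp, isOpen_slit.mem_nhds hs] with q hq hqs
  rw [f₂, ← delta_eq hF hq hqs, chartCoeff₂, matsumotoCoeff₂, crdSymm_crd hq]

theorem contDiffAt_chartPhi (hF : IsFinsler F) (hφ : IsConcurrent F φ) (hp : p ∈ chartDom o)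
    (hs : p ∈ slit E M) : ContDiffAt ℝ ∞ (chartPhi o F φ) (crd o p) :=
  (hφ.isModelConcurrent hF o).contDiffAt_modelPhi (hF.isModelEnergy o)
    ((crd_mem_slitTarget hp).2 hs)

theorem contDiffAt_chartDelta (hF : IsFinsler F) (hφ : IsConcurrent F φ) (hp : p ∈ chartDom o)
    (hs : p ∈ slit E M) : ContDiffAt ℝ ∞ (fun z => F (crdSymm o z) * (1 + 2 * chartPSq o F φ z)
      - 3 * chartPhi o F φ z) (crd o p) := by
  have hz := (crd_mem_slitTarget hp).2 hs
  have hc := hφ.isModelConcurrent hF o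
  have h1 : ContDiffAt ℝ ∞ (chartPSq o F φ) (crd o p) :=
    hc.contDiffAt_metric (hF.isModelEnergy o) hz (hc.smooth _ hz)
  exact ((hF.contDiffAt hp hs).mul (contDiffAt_const.add (contDiffAt_const.mul h1))).sub
    (contDiffAt_const.mul (contDiffAt_chartPhi hF hφ hp hs))

theorem contDiffAt_chartCoeff₁ (hF : IsFinsler F) (hφ : IsConcurrent F φ) (hp : p ∈ chartDom o)
    (hs : p ∈ slit E M) (hΔ : deltaFun F φ p ≠ 0) :
    ContDiffAt ℝ ∞ (chartCoeff₁ o F φ) (crd o p) := by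
  refine ContDiffAt.div ?_ (contDiffAt_chartDelta hF hφ hp hs) (by rwa [delta_eq hF hp hs])
  exact (hF.contDiffAt hp hs).mul ((contDiffAt_const.mul (contDiffAt_chartPhi hF hφ hp hs)).sub
    (hF.contDiffAt hp hs))

theorem contDiffAt_chartCoeff₂ (hF : IsFinsler F) (hφ : IsConcurrent F φ) (hp : p ∈ chartDom o)
    (hs : p ∈ slit E M) (hΔ : deltaFun F φ p ≠ 0) :
    ContDiffAt ℝ ∞ (chartCoeff₂ o F φ) (crd o p) := by
  refine ContDiffAt.div ?_ (contDiffAt_chartDelta hF hφ hp hs) (by rwa [delta_eq hF hp hs])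
  exact contDiffAt_const.mul ((hF.contDiffAt hp hs).pow 3)

/-- The spray of `F² / (F - Φ)` in coordinates. -/
theorem dcrd_spray_matsumoto (hF : IsFinsler F) (hφ : IsConcurrent F φ) (hp : p ∈ chartDom o)
    (hs : p ∈ slit E M) (hr : bigPhi F φ p < F p) (hΔ : deltaFun F φ p ≠ 0)
    (hm : MaxRankAt (matsumoto F φ) p) :
    dcrd o p (spray (matsumoto F φ) p) = chartMatsumotoSpray o F φ (crd o p) := by
  have hz := (crd_mem_slitTarget hp).2 hs
  have hF0 := hF.contDiffAt hp hs
  have hΦ0 := contDiffAt_chartPhi hF hφ hp hs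
  have hFp : F (crdSymm o (crd o p)) = F p := by rw [crdSymm_crd hp]
  have hr' : F (crdSymm o (crd o p)) - chartPhi o F φ (crd o p) ≠ 0 := by
    rw [hFp, chartPhi_crd hF hp hs]
    exact sub_ne_zero.2 hr.ne'
  have hrep : HasRep o (energy (matsumoto F φ))
      (matsumotoEnergy (fun z => F (crdSymm o z)) (chartPhi o F φ)) p := by
    filter_upwards [chartDom_mem_nhds hp, isOpen_slit.mem_nhds hs] with q hq hqs
    rw [energy, matsumoto, matsumotoEnergy, crdSymm_crd hq, chartPhi_crd hF hq hqs]
  have hsm : ContDiffAt ℝ ∞ (matsumotoEnergy (fun z => F (crdSymm o z)) (chartPhi o F φ))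
      (crd o p) :=
    contDiffAt_const.mul (((hF0.pow 2).div (hF0.sub hΦ0) hr').pow 2)
  obtain ⟨ξ, hξ⟩ := dcrd_surjective hp (chartMatsumotoSpray o F φ (crd o p))
  rw [hm.spray_eq hp hrep hsm (ξ := ξ) fun w => ?_, hξ]
  rw [hξ]
  exact omega_matsumotoEnergy (hF.isModelEnergy o) (hφ.isModelConcurrent hF o) hz hF0
    (by rw [hFp]; exact hF.ne_zero hs) rfl hr' rfl ((delta_eq hF hp hs).trans_ne hΔ) w

theorem contDiffAt_chartMatsumotoSpray (hF : IsFinsler F) (hφ : IsConcurrent F φ)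
    (hp : p ∈ chartDom o) (hs : p ∈ slit E M) (hΔ : deltaFun F φ p ≠ 0) :
    ContDiffAt ℝ ∞ (chartMatsumotoSpray o F φ) (crd o p) :=
  ((hF.contDiffAt_spray hp hs).sub ((contDiffAt_chartCoeff₁ hF hφ hp hs hΔ).smul
    (contDiffAt_const.prodMk contDiffAt_snd))).add
      ((contDiffAt_chartCoeff₂ hF hφ hp hs hΔ).smul (contDiffAt_const.prodMk
        ((hφ.isModelConcurrent hF o).smooth _ ((crd_mem_slitTarget hp).2 hs))))

theorem eventually_chartMatsumotoSpray_fst (hF : IsFinsler F) (hp : p ∈ chartDom o)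
    (hs : p ∈ slit E M) : ∀ᶠ z in nhds (crd o p), (chartMatsumotoSpray o F φ z).1 = z.2 := by
  filter_upwards [hF.eventually_spray_fst hp hs] with z hz
  simp [chartMatsumotoSpray, hz]

/-- Brackets need the components of the spray on a neighbourhood, and the domain is open, so the
pointwise formula extends to nearby points. -/
theorem spray_matsumoto_hasComps (hF : IsFinsler F) (hφ : IsConcurrent F φ)
    (hM : IsConicPseudoFinsler (matsumotoDomain F φ) (matsumoto F φ))
    (hΔ : ∀ u ∈ matsumotoDomain F φ, deltaFun F φ u ≠ 0) (hp : p ∈ chartDom o)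
    (hD : p ∈ matsumotoDomain F φ) :
    HasComps o (spray (matsumoto F φ)) (chartMatsumotoSpray o F φ) p := by
  filter_upwards [chartDom_mem_nhds hp, hM.conic.isOpen.mem_nhds hD] with q hq hqD
  exact dcrd_spray_matsumoto hF hφ hq hqD.1 hqD.2 (hΔ q hqD) (hM.maxRank q hqD)

/-- The vertical derivatives of the spray of `F² / (F - Φ)`. -/
theorem fderiv_chartMatsumotoSpray (hF : IsFinsler F) (hφ : IsConcurrent F φ)
    (hp : p ∈ chartDom o) (hs : p ∈ slit E M) (hΔ : deltaFun F φ p ≠ 0)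
    (v : TangentSpace 𝓘(ℝ, E).tangent p) :
    (fderiv ℝ (chartMatsumotoSpray o F φ) (crd o p) (0, (dcrd o p v).1)).2 =
      (fderiv ℝ (modelSpray (chartEnergy o F)) (crd o p) (0, (dcrd o p v).1)).2
        - f₁ F φ p • (dcrd o p v).1 - dJ (f₁ F φ) p v • (crd o p).2
        + dJ (f₂ F φ) p v • bcrd o p (φ p) := by
  have hz := (crd_mem_slitTarget hp).2 hs
  have hc := hφ.isModelConcurrent hF o
  have hd1 := ((contDiffAt_chartCoeff₁ hF hφ hp hs hΔ).differentiableAt (by simp)).hasFDerivAt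
  have hd2 := ((contDiffAt_chartCoeff₂ hF hφ hp hs hΔ).differentiableAt (by simp)).hasFDerivAt
  have hder := ((((hF.contDiffAt_spray hp hs).differentiableAt (by simp)).hasFDerivAt).sub
    (hd1.smul ((hasFDerivAt_const (0 : E) (crd o p)).prodMk
      (hasFDerivAt_snd (𝕜 := ℝ) (E := E) (F := E))))).add
    (hd2.smul ((hasFDerivAt_const (0 : E) (crd o p)).prodMk
      ((hc.smooth _ hz).differentiableAt (by simp)).hasFDerivAt))
  have hder' : fderiv ℝ (chartMatsumotoSpray o F φ) (crd o p) = _ := hder.fderiv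
  rw [(hasPiComps_piComps φ hp).self_of_nhds, (f₁_hasRep hF hp hs).dJ_eq hp hd1.differentiableAt,
    (f₂_hasRep hF hp hs).dJ_eq hp hd2.differentiableAt, (f₁_hasRep hF hp hs).self_of_nhds, hder']
  -- The product rule for `f₂ φ` would add `f₂ ∂_y φ`, which vanishes.
  simp [hc.fderiv_vert _ hz]
  module

theorem barthel_matsumoto (hF : IsFinsler F) (hφ : IsConcurrent F φ)
    (hM : IsConicPseudoFinsler (matsumotoDomain F φ) (matsumoto F φ))
    (hΔ : ∀ u ∈ matsumotoDomain F φ, deltaFun F φ u ≠ 0)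
    {u : TangentBundle 𝓘(ℝ, E) M} (hu : u ∈ matsumotoDomain F φ)
    (W : TangentSpace 𝓘(ℝ, E).tangent u) :
    barthel (matsumoto F φ) u W =
      barthel F u W - f₁ F φ u • vertJ u W - dJ (f₁ F φ) u W • liouville u
        + dJ (f₂ F φ) u W • gam u (φ u) := by
  have hp := mem_chartDom_self (o := u)
  have hs : u ∈ slit E M := hu.1
  apply dcrd_injective hp
  rw [dcrd_barthel hp (spray_matsumoto_hasComps hF hφ hM hΔ hp hu)
      ((contDiffAt_chartMatsumotoSpray hF hφ hp hs (hΔ u hu)).of_le (by norm_cast))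
      (eventually_chartMatsumotoSpray_fst hF hp hs),
    fderiv_chartMatsumotoSpray hF hφ hp hs (hΔ u hu), map_add, map_sub, map_sub,
    dcrd_barthel hp (hF.spray_hasComps hp hs)
      ((hF.contDiffAt_spray hp hs).of_le (by norm_cast)) (hF.eventually_spray_fst hp hs),
    map_smul, map_smul, map_smul, dcrd_vertJ hp, (liouville_hasComps hp).self_of_nhds,
    dcrd_gam hp]
  refine Prod.ext ?_ ?_
  · simp
  · simp
    module

theorem bet_matsumoto (hF : IsFinsler F) (hφ : IsConcurrent F φ)
    (hM : IsConicPseudoFinsler (matsumotoDomain F φ) (matsumoto F φ))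
    (hΔ : ∀ u ∈ matsumotoDomain F φ, deltaFun F φ u ≠ 0)
    {u : TangentBundle 𝓘(ℝ, E) M} (hu : u ∈ matsumotoDomain F φ)
    (W : TangentSpace 𝓘(ℝ, E) u.proj) :
    bet (matsumoto F φ) u W =
      bet F u W - (1 / 2 : ℝ) • (f₁ F φ u • gam u W
        + dJ (f₁ F φ) u (bet F u W) • liouville u
        - dJ (f₂ F φ) u (bet F u W) • gam u (φ u)) := by
  have hp := mem_chartDom_self (o := u)
  have hs : u ∈ slit E M := hu.1
  have h1 := hF.dcrd_bet hp hs W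
  have h2 : (dcrd u u (bet F u W)).1 = bcrd u u W := by rw [h1]; rfl
  have h3 := fderiv_chartMatsumotoSpray hF hφ hp hs (hΔ u hu) (bet F u W)
  rw [h2] at h3
  apply dcrd_injective hp
  rw [dcrd_bet hp (spray_matsumoto_hasComps hF hφ hM hΔ hp hu)
      ((contDiffAt_chartMatsumotoSpray hF hφ hp hs (hΔ u hu)).of_le (by norm_cast))
      (eventually_chartMatsumotoSpray_fst hF hp hs), map_sub, h1, map_smul, map_sub, map_add,
    map_smul, map_smul, map_smul, (liouville_hasComps hp).self_of_nhds, dcrd_gam hp, dcrd_gam hp]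
  refine Prod.ext ?_ ?_
  · simp [modelHor]
  · simp only [modelHor, h3, Prod.snd_sub, Prod.snd_add, Prod.smul_snd]
    module

end Main

end FinslerGeom

end

theorem mainTheorem6
    {E : Type*} [NormedAddCommGroup E] [NormedSpace ℝ E] [FiniteDimensional ℝ E]
    {M : Type*} [TopologicalSpace M] [T2Space M] [ParacompactSpace M]
    [ChartedSpace E M] [IsManifold 𝓘(ℝ, E) ∞ M]
    (F : TangentBundle 𝓘(ℝ, E) M → ℝ) (hF : FinslerGeom.IsFinsler F)
    (φ : FinslerGeom.PiField E M) (hφ : FinslerGeom.IsConcurrent F φ)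
    (hM : FinslerGeom.IsConicPseudoFinsler
      (FinslerGeom.matsumotoDomain F φ) (FinslerGeom.matsumoto F φ))
    (hΔ : ∀ u ∈ FinslerGeom.matsumotoDomain F φ, FinslerGeom.deltaFun F φ u ≠ 0) :
    (∀ u ∈ FinslerGeom.matsumotoDomain F φ,
      ∀ W : TangentSpace 𝓘(ℝ, E).tangent u,
        FinslerGeom.barthel (FinslerGeom.matsumoto F φ) u W =
          FinslerGeom.barthel F u W
          - FinslerGeom.f₁ F φ u • FinslerGeom.vertJ u W
          - FinslerGeom.dJ (FinslerGeom.f₁ F φ) u W • FinslerGeom.liouville u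
          + FinslerGeom.dJ (FinslerGeom.f₂ F φ) u W • FinslerGeom.gam u (φ u)) ∧
    (∀ u ∈ FinslerGeom.matsumotoDomain F φ,
      ∀ W : TangentSpace 𝓘(ℝ, E) u.proj,
        FinslerGeom.bet (FinslerGeom.matsumoto F φ) u W =
          FinslerGeom.bet F u W
          - (1 / 2 : ℝ) • (FinslerGeom.f₁ F φ u • FinslerGeom.gam u W
            + FinslerGeom.dJ (FinslerGeom.f₁ F φ) u (FinslerGeom.bet F u W)
                • FinslerGeom.liouville u
            - FinslerGeom.dJ (FinslerGeom.f₂ F φ) u (FinslerGeom.bet F u W)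
                • FinslerGeom.gam u (φ u))) := by
  exact ⟨fun _ hu W => FinslerGeom.barthel_matsumoto hF hφ hM hΔ hu W,
    fun _ hu W => FinslerGeom.bet_matsumoto hF hφ hM hΔ hu W⟩
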